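/- Let $K$ be any field, let $c\ge 1$, $t\ge 0$, and let $R=K[x_0,\dots,x_n]$ with $n+1>c$. Choose $2t+c$ linear forms $$\mathcal M_{c,t}=\{M_0,\dots,M_{t+\lfloor\frac{c-1}{2}\rfloor},\,L_0,\dots,L_{t+\lfloor\frac{c-2}{2}\rfloor}\}$$ in $R$ and define $$I_{Z_{c,t}}=\bigcap_{0\le i_1\le i_2<i_3\le i_4<\dots<i_{c-1}\le i_c\le t+\frac{c-2}{2}}(M_{i_1},L_{i_2},M_{i_3},L_{i_4},\dots,L_{i_c})\quad\text{if $c$ is even,}$$ $$I_{Z_{c,t}}=\bigcap_{0\le i_1\le i_2<i_3\le i_4<\dots\le i_{c-1}<i_c\le t+\frac{c-1}{2}}(M_{i_1},L_{i_2},M_{i_3},L_{i_4},\dots,M_{i_c})\quad\text{if $c$ is odd}$$ (for $c=1$ the range is $0\le i_1\le t$). (a) If each subset consisting of $\min\{c+1,2t+c\}$ of the $2t+c$ linear forms generates an ideal of codimension $\min\{c+1,2t+c\}$ (for $t\ge1$ this number is $c+1$), then $I_{Z_{c,t}}$ is a radical ideal of codimension $c$, the ring $R/I_{Z_{c,t}}$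 is Cohen–Macaulay, and its $h$-vector is $$\left(1,\,c,\,\binom{c+1}{2},\,\dots,\,\binom{c+t-1}{t}\right).$$ Here $(h_0,\dots,h_t)$ is the $h$-vector of $A=R/I$ if the Hilbert series of $A$ is $(h_0+h_1z+\dots+h_tz^t)/(1-z)^{\dim A}$; and $j\mapsto h_j$ (with $h_j=0$ for $j>t$) is also the Hilbert function of every Artinian reduction of $A$, that is, of every quotient of $A$ by a regular sequence of $\dim A$ linear forms. (b) If each subset consisting of $\min\{c+2,2t+c\}$ of the $2t+c$ linear forms generates a complete intersection of codimension $\min\{c+2,2t+c\}$ (for $t\ge1$ this number is $c+2$), then $I_{Z_{c,t}}$ defines a generalized stick figure of dimension $d=n-c$ in $\mathbb P^n$: it is the radical ideal of a union of $d$-dimensional linear subvarieties such that the intersection of any three distinct components has dimension at most $d-2$, where the empty set has dimension $-1$. -/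

import Mathlib

namespace LinearConfig

/-- A Cohen–Macaulay local ring: Noetherian, and the maximal ideal contains a regular sequence
whose length is the Krull dimension. -/
def IsCMLocalRing (A : Type*) [CommRing A] [IsLocalRing A] : Prop :=
  IsNoetherianRing A ∧ ∃ rs : List A, (∀ r ∈ rs, r ∈ IsLocalRing.maximalIdeal A) ∧
    RingTheory.Sequence.IsRegular A rs ∧ ringKrullDim A = (rs.length : WithBot ℕ∞)

/-- A Cohen–Macaulay ring: Noetherian, and all localizations at primes are Cohen–Macaulay. -/
def IsCMRing (A : Type*) [CommRing A] : Prop :=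
  IsNoetherianRing A ∧ ∀ (p : Ideal A) [p.IsPrime], IsCMLocalRing (Localization.AtPrime p)

section

variable {K : Type*} [Field K] {n : ℕ}

/-- The Hilbert function `j ↦ dim_K [R/I]_j`, where `R = K[x_0, …, x_n]`. -/
noncomputable def hilbertFunction (I : Ideal (MvPolynomial (Fin (n + 1)) K)) (j : ℕ) : ℕ :=
  Module.finrank K
    ((MvPolynomial.homogeneousSubmodule (Fin (n + 1)) K j).map
      (Ideal.Quotient.mkₐ K I).toLinearMap)

/-- `R/J` is an Artinian reduction of `R/I`: the quotient of `R/I` by a regular sequence of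
`dim R/I` linear forms. -/
def IsArtinianReduction (I J : Ideal (MvPolynomial (Fin (n + 1)) K)) : Prop :=
  ∃ θ : List (MvPolynomial (Fin (n + 1)) K), (∀ f ∈ θ, f.IsHomogeneous 1) ∧
    RingTheory.Sequence.IsRegular (MvPolynomial (Fin (n + 1)) K ⧸ I) θ ∧
    ringKrullDim (MvPolynomial (Fin (n + 1)) K ⧸ I) = (θ.length : WithBot ℕ∞) ∧
    J = I ⊔ Ideal.ofList θ

/-- `h` (extended by zeros) is the `h`-vector of `R/I`: with `D = dim R/I`, the Hilbert series of
`R/I` is `(∑ h_j z^j) / (1 - z)^D`, and `h` is the Hilbert function of every Artinian reduction of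
`R/I`. The first clause gives the `h`-vector a meaning over fields that are too small for a linear
Artinian reduction to exist. -/
structure HasHVector (I : Ideal (MvPolynomial (Fin (n + 1)) K)) (h : ℕ → ℕ) : Prop where
  series : ∃ D : ℕ, ringKrullDim (MvPolynomial (Fin (n + 1)) K ⧸ I) = (D : WithBot ℕ∞) ∧
    PowerSeries.mk (fun j => (hilbertFunction I j : ℤ)) * (1 - PowerSeries.X) ^ D =
      PowerSeries.mk (fun j => (h j : ℤ))
  artinian : ∀ J, IsArtinianReduction I J → ∀ j, hilbertFunction J j = h j

/-- The ideal is generated by linear forms, i.e. it is the ideal of a linear subvariety. -/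
def IsLinearIdeal (P : Ideal (MvPolynomial (Fin (n + 1)) K)) : Prop :=
  ∃ S : Set (MvPolynomial (Fin (n + 1)) K), (∀ f ∈ S, f.IsHomogeneous 1) ∧ P = Ideal.span S

/-- `I` defines a generalized stick figure of dimension `d` in `ℙ^n`: `I` is radical, its minimal
primes are the ideals of `d`-dimensional linear subvarieties (coordinate ring of Krull dimension
`d + 1`), and any three distinct components meet in projective dimension at most `d - 2`, i.e. the
coordinate ring of the intersection has Krull dimension at most `d - 1`. The empty set,
of dimension `-1`, is the case of Krull dimension `0`. -/
structure IsGeneralizedStickFigure (I : Ideal (MvPolynomial (Fin (n + 1)) K)) (d : ℕ) : Prop where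
  radical : I.IsRadical
  linear : ∀ P ∈ I.minimalPrimes, IsLinearIdeal P
  dim : ∀ P ∈ I.minimalPrimes,
    ringKrullDim (MvPolynomial (Fin (n + 1)) K ⧸ P) = ((d + 1 : ℕ) : WithBot ℕ∞)
  triple : ∀ P₁ ∈ I.minimalPrimes, ∀ P₂ ∈ I.minimalPrimes, ∀ P₃ ∈ I.minimalPrimes,
    P₁ ≠ P₂ → P₁ ≠ P₃ → P₂ ≠ P₃ →
    ringKrullDim (MvPolynomial (Fin (n + 1)) K ⧸ (P₁ ⊔ P₂ ⊔ P₃)) + 1 ≤ (d : WithBot ℕ∞)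

/-- The index sequences `0 ≤ i_1 ≤ i_2 < i_3 ≤ i_4 < ⋯ ≤ t + ⌊(c-1)/2⌋` of length `c`. Positions
are numbered from `0` here, so that `i k` is `i_{k+1}`. For even `c` the bound is
`t + (c-2)/2`. -/
def IsAdmissible (c t : ℕ) (i : Fin c → ℕ) : Prop :=
  (∀ k, i k ≤ t + (c - 1) / 2) ∧
  ∀ k l : Fin c, (l : ℕ) = k + 1 → if Even (k : ℕ) then i k ≤ i l else i k < i l

/-- The ideal `(M_{i_1}, L_{i_2}, M_{i_3}, L_{i_4}, …)`, with `c` generators. -/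
noncomputable def altIdeal (M L : ℕ → MvPolynomial (Fin (n + 1)) K) (c : ℕ) (i : Fin c → ℕ) :
    Ideal (MvPolynomial (Fin (n + 1)) K) :=
  Ideal.span (Set.range fun k : Fin c => if Even (k : ℕ) then M (i k) else L (i k))

/-- The ideal `I_{Z_{c,t}}`. -/
noncomputable def idealZ (M L : ℕ → MvPolynomial (Fin (n + 1)) K) (c t : ℕ) :
    Ideal (MvPolynomial (Fin (n + 1)) K) :=
  ⨅ (i : Fin c → ℕ) (_ : IsAdmissible c t i), altIdeal M L c i

/-- The `2t + c` forms `M_0, …, M_{t + ⌊(c-1)/2⌋}, L_0, …, L_{t + ⌊(c-2)/2⌋}`. -/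
def forms (M L : ℕ → MvPolynomial (Fin (n + 1)) K) (c t : ℕ) :
    Fin (t + (c + 1) / 2) ⊕ Fin (t + c / 2) → MvPolynomial (Fin (n + 1)) K :=
  Sum.elim (fun a => M a) (fun b => L b)

/-- Each subset consisting of `m` of the `2t + c` forms generates an ideal of codimension `m`. -/
def SubsetsHaveCodim (M L : ℕ → MvPolynomial (Fin (n + 1)) K) (c t m : ℕ) : Prop :=
  ∀ S : Finset (Fin (t + (c + 1) / 2) ⊕ Fin (t + c / 2)), S.card = m →
    (Ideal.span (forms M L c t '' (S : Set _))).height = (m : ℕ∞)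

end

end LinearConfig

/-!
List the forms as `F_0, F_1, … = M_0, L_0, M_1, L_1, …`. The components of `Z_{c,t}` become the ideals
`P_s = (F_j : j ∈ s)`, where `s = {2 m_k + k : k < c}` for a weakly increasing sequence
`0 ≤ m_0 ≤ ⋯ ≤ m_{c-1} ≤ t` (`idealZ_eq_altInf`). By Krull's height theorem the codimension hypothesis
says that any `c + 1` of the forms are linearly independent, and an ideal generated by linear forms is
prime, of height the number of independent generators. So `I_{c,t} = ⋂ P_s` is radical of height `c`.

Put `A = I_{c,t+1}`, `B = I_{c+1,t}` and let `f` be the last form `F_{2(t+1)+c}`. According to whether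
`f` is one of the generators, the components of `I_{c+1,t+1}` are those of `A` with `f` added, and
those of `B`. Now `A ⊆ B`, and `f` is a nonzerodivisor modulo `A` and modulo `B`, whence
`I_{c+1,t+1} = (A + (f)) ∩ B = A + f B`, a basic double link (`altInf_eq_linkIdeal`). That the
intersection of the ideals `P_s + (f)` is no larger than `A + (f)` is not formal. It holds because the
recursive description of `A` commutes with passing to `R/f`, where the remaining forms still satisfy
the hypothesis for one form less.

Everything else is read off the link, by `altInf_induction`. The exact sequences
`0 → B/A → R/A → R/B → 0` and `0 → B/A → R/A → R/(A + f B) → 0` bound the depth of all localizations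
from below (`DepthGE.doubleLink`, with depth measured by the vanishing of `Ext`), starting from the
regular local rings `R_p`; the height bounds the dimension by the same number, so the quotient is
Cohen–Macaulay. The Hilbert series satisfy `H(A + f B) = (1 - z) H(A) + z H(B)`
(`hilbertSeries_doubleLink`), which turns into Pascal's rule for the `h`-vector. A regular sequence of
linear forms multiplies the Hilbert series by a power of `1 - z`, which gives the statement on Artinian
reductions.

For the stick figure, in a set `s` as above each element has the parity of its position. Hence three
distinct index sets cannot lie in a common set of `c + 1` elements (`add_two_le_card_union`), so the sum
of three components contains `c + 2` independent forms.
-/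

/-! ### Height, dimension and regular local rings -/

namespace LinearConfig

open IsLocalRing RingTheory.Sequence

universe u

theorem height_add_ringKrullDim_quotient_le {A : Type*} [CommRing A] (I : Ideal A) :
    (I.height : WithBot ℕ∞) + ringKrullDim (A ⧸ I) ≤ ringKrullDim A := by
  have key : ∀ l : LTSeries (PrimeSpectrum.zeroLocus (I : Set A)),
      (I.height : WithBot ℕ∞) + (l.length : WithBot ℕ∞) ≤ ringKrullDim A := by
    intro l
    have h : ∀ i : Fin (l.length + 1), I.height + (i : ℕ) ≤ (l i).1.asIdeal.height := by
      intro i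
      induction i using Fin.induction with
      | zero => simpa using Ideal.height_mono (l 0).2
      | succ i ih =>
        have hlt : (l i.castSucc).1.asIdeal < (l i.succ).1.asIdeal :=
          l.strictMono (Fin.castSucc_lt_succ (i := i))
        refine le_trans ?_ (Ideal.height_add_one_le_of_lt_of_isPrime hlt)
        simpa [← add_assoc] using add_le_add_left ih 1
    have h1 := h (Fin.last _)
    have h2 : (((l (Fin.last _)).1.asIdeal.height : ℕ∞) : WithBot ℕ∞) ≤ ringKrullDim A :=
      Ideal.height_le_ringKrullDim_of_isPrime
    refine le_trans ?_ h2
    have := WithBot.coe_le_coe.2 h1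
    simpa using this
  rw [ringKrullDim_quotient, Order.krullDim]
  rcases isEmpty_or_nonempty (LTSeries (PrimeSpectrum.zeroLocus (I : Set A))) with h | h
  · simp
  · have hne : Nonempty (PrimeSpectrum.zeroLocus (I : Set A)) := h.map fun l => l 0
    rw [← Order.krullDim, Order.krullDim_eq_iSup_length, ← WithBot.coe_add, ENat.add_iSup,
      WithBot.coe_iSup (OrderTop.bddAbove _)]
    exact ciSup_le' fun l => by simpa using key l

/-- An element of `𝔪` outside `𝔪²` can be exchanged for a member of a finite generating set of
`𝔪`. -/
theorem exists_span_insert_erase {A : Type*} [CommRing A] [IsLocalRing A] [DecidableEq A]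
    {G : Finset A} (hG : Ideal.span (G : Set A) = maximalIdeal A) {x : A}
    (hx : x ∈ maximalIdeal A) (hx2 : x ∉ maximalIdeal A ^ 2) :
    ∃ g ∈ G, Ideal.span (insert x (G.erase g : Set A)) = maximalIdeal A := by
  have hx' := hx
  rw [← hG, Submodule.mem_span_finset'] at hx'
  obtain ⟨a, ha⟩ := hx'
  have hGm : ∀ g ∈ G, g ∈ maximalIdeal A := fun g hg => hG ▸ Ideal.subset_span hg
  have : ∃ g : G, IsUnit (a g) := by
    by_contra! hcon
    apply hx2
    rw [← ha, pow_two]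
    exact Ideal.sum_mem _ fun g _ => Ideal.mul_mem_mul ((mem_maximalIdeal _).2 (hcon g)) (hGm _ g.2)
  obtain ⟨g, u, hu⟩ := this
  refine ⟨g, g.2, le_antisymm ?_ ?_⟩
  · rw [Ideal.span_le]
    rintro y (rfl | hy)
    · exact hx
    · exact hGm y (Finset.mem_of_mem_erase hy)
  · rw [← hG, Ideal.span_le]
    intro y hy
    by_cases hyg : y = g
    · subst hyg
      have h1 : a g * g ∈ Ideal.span (insert x (G.erase g : Set A)) := by
        have : a g * (g : A) = x - ∑ i ∈ Finset.univ.erase g, a i • (i : A) := by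
          rw [← ha, ← Finset.add_sum_erase _ _ (Finset.mem_univ g)]; simp
        rw [this]
        refine Ideal.sub_mem _ (Ideal.subset_span (by simp)) (Ideal.sum_mem _ fun i hi => ?_)
        refine Ideal.mul_mem_left _ _ (Ideal.subset_span (Set.mem_insert_of_mem _ ?_))
        rw [Finset.mem_erase] at hi
        exact Finset.mem_erase.2 ⟨fun h => hi.1 (Subtype.ext h), i.2⟩
      rw [← hu] at h1
      exact (Ideal.unit_mul_mem_iff_mem _ u.isUnit).1 h1
    · exact Ideal.subset_span (Set.mem_insert_of_mem _ (Finset.mem_erase.2 ⟨hyg, hy⟩))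

theorem isWeaklyRegular_cons_of_quotient {A : Type*} [CommRing A] {x : A}
    (hx : IsSMulRegular A x) {rs : List A}
    (h : IsWeaklyRegular (A ⧸ Ideal.span {x}) (rs.map (Ideal.Quotient.mk (Ideal.span {x})))) :
    IsWeaklyRegular A (x :: rs) := by
  rw [isWeaklyRegular_cons_iff]
  refine ⟨hx, ?_⟩
  have h' : IsWeaklyRegular (A ⧸ Ideal.span {x}) rs :=
    (isWeaklyRegular_map_algebraMap_iff (A ⧸ Ideal.span {x}) (A ⧸ Ideal.span {x}) rs).1 h
  have e : QuotSMulTop x A ≃ₗ[A] (A ⧸ Ideal.span {x}) :=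
    Submodule.quotEquivOfEq _ _ (by
      rw [← Submodule.ideal_span_singleton_smul]; simp)
  exact (e.isWeaklyRegular_congr rs).2 h'

/-- A local ring whose maximal ideal is generated by at most `dim A` elements is a domain with a
regular sequence of that length in `𝔪`. The quotient by a generator `x` outside the minimal primes is
again such a ring, hence a domain, so `(x)` is a prime strictly containing a minimal prime `q`; then
`q = x q`, and `q = 0` by Nakayama's lemma. -/
theorem isDomain_and_exists_isWeaklyRegular (d : ℕ) : ∀ (A : Type u) [CommRing A] [IsLocalRing A]
    [IsNoetherianRing A] (G : Finset A), Ideal.span (G : Set A) = maximalIdeal A → G.card = d →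
    (d : WithBot ℕ∞) ≤ ringKrullDim A →
    IsDomain A ∧ ∃ rs : List A, (∀ r ∈ rs, r ∈ maximalIdeal A) ∧ rs.length = d ∧
      IsWeaklyRegular A rs := by
  classical
  induction d with
  | zero =>
    intro A _ _ _ G hG hc _
    rw [Finset.card_eq_zero] at hc
    subst hc
    have : IsField A := by
      rw [isField_iff_maximalIdeal_eq, ← hG]; simp
    exact ⟨this.isDomain, [], by simp⟩
  | succ d ih =>
    intro A _ _ _ G hG hc hd
    have hht : ((d + 1 : ℕ) : ℕ∞) ≤ (maximalIdeal A).height := by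
      rw [← maximalIdeal_height_eq_ringKrullDim] at hd
      exact_mod_cast hd
    have hmin : ∀ q ∈ minimalPrimes A, ¬ maximalIdeal A ≤ q := by
      intro q hq hle
      have hqp : q.IsPrime := hq.1.1
      have h0 : q.height = 0 := Ideal.height_eq_zero_iff.2 hq
      have := hht.trans (Ideal.height_mono hle)
      rw [h0] at this
      simp at this
    have hsq : ¬ maximalIdeal A ≤ maximalIdeal A ^ 2 := by
      intro hle
      have h0 : maximalIdeal A = ⊥ := by
        refine Submodule.eq_bot_of_le_smul_of_le_jacobson_bot (maximalIdeal A) _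
          (IsNoetherian.noetherian _) ?_ (maximalIdeal_le_jacobson _)
        simpa [pow_two] using hle
      rw [h0, Ideal.height_bot] at hht
      simp at hht
    have hfin := minimalPrimes.finite_of_isNoetherianRing A
    -- prime avoidance tolerates the ideal `𝔪²`, which is not prime
    obtain ⟨x, hx, hxn⟩ : ∃ x ∈ maximalIdeal A, x ∉ maximalIdeal A ^ 2 ∧
        ∀ q ∈ minimalPrimes A, x ∉ q := by
      by_contra! hcon
      have := (Ideal.subset_union_prime (s := insert (maximalIdeal A ^ 2) hfin.toFinset)
        (f := id) (maximalIdeal A ^ 2) (maximalIdeal A ^ 2) (I := maximalIdeal A) (by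
          intro i hi h1 _
          simp [h1] at hi
          exact hi.1.1)).1 (by
          intro x hx
          simp only [Finset.coe_insert, Set.mem_iUnion, id]
          by_cases h : x ∈ maximalIdeal A ^ 2
          · exact ⟨_, Or.inl rfl, h⟩
          · obtain ⟨q, hq, hxq⟩ := hcon x hx h
            exact ⟨q, Or.inr (by simpa using hq), hxq⟩)
      obtain ⟨i, hi, hle⟩ := this
      simp only [Finset.mem_insert, Set.Finite.mem_toFinset, id] at hi hle
      rcases hi with rfl | hi
      · exact hsq hle
      · exact hmin i hi hle
    obtain ⟨g, hg, hspan⟩ := exists_span_insert_erase hG hx hxn.1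
    let I := Ideal.span {x}
    have hIm : I ≤ maximalIdeal A := (Ideal.span_singleton_le_iff_mem _).2 hx
    have : Nontrivial (A ⧸ I) := Ideal.Quotient.nontrivial_iff.2
      (ne_top_of_le_ne_top Ideal.IsPrime.ne_top' hIm)
    have : IsLocalRing (A ⧸ I) := IsLocalRing.of_surjective' _ Ideal.Quotient.mk_surjective
    have hmap : (maximalIdeal A).map (Ideal.Quotient.mk I) = maximalIdeal (A ⧸ I) := by
      have hloc : IsLocalHom (Ideal.Quotient.mk I) :=
        .of_surjective _ Ideal.Quotient.mk_surjective
      rw [← Ideal.map_comap_of_surjective _ Ideal.Quotient.mk_surjective (maximalIdeal (A ⧸ I)),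
        IsLocalRing.maximalIdeal_comap]
    have hspan' : Ideal.span (((G.erase g).image (Ideal.Quotient.mk I) : Finset (A ⧸ I)) :
        Set (A ⧸ I)) = maximalIdeal (A ⧸ I) := by
      rw [← hmap, ← hspan, Ideal.map_span, Set.image_insert_eq]
      have : Ideal.Quotient.mk I x = 0 := Ideal.Quotient.eq_zero_iff_mem.2
        (Ideal.mem_span_singleton_self x)
      rw [this, Ideal.span_insert_zero]
      simp
    have hcard : (G.erase g).card = d := by rw [Finset.card_erase_of_mem hg, hc]; rfl
    have hdim : (d : WithBot ℕ∞) ≤ ringKrullDim (A ⧸ I) := by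
      have h1 : ringKrullDim A ≤ ringKrullDim (A ⧸ I) + 1 := by
        rw [← maximalIdeal_height_eq_ringKrullDim]
        exact Ideal.height_le_ringKrullDim_quotient_add_one hx
      have h2 := hd.trans h1
      rw [Nat.cast_add, Nat.cast_one] at h2
      exact ENat.WithBot.add_le_add_one_right_iff.1 h2
    have hcard' : ((G.erase g).image (Ideal.Quotient.mk I)).card = d := by
      refine le_antisymm (Finset.card_image_le.trans hcard.le) ?_
      have h1 := hdim.trans (ringKrullDim_le_spanFinrank_maximalIdeal (A ⧸ I))
      rw [← hspan'] at h1
      have h2 := Submodule.spanFinrank_span_le_ncard_of_finite (R := A ⧸ I)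
        (Finset.finite_toSet ((G.erase g).image (Ideal.Quotient.mk I)))
      rw [Set.ncard_coe_finset] at h2
      exact (by exact_mod_cast h1 : d ≤ _).trans h2
    obtain ⟨hdom, rs', hrs, hlen, hreg⟩ := ih (A ⧸ I) _ hspan' hcard' hdim
    have hIp : I.IsPrime := (Ideal.Quotient.isDomain_iff_prime I).1 hdom
    have hA : IsDomain A := by
      obtain ⟨q, hq, hqI⟩ := Ideal.exists_minimalPrimes_le (I := (⊥ : Ideal A)) (J := I) bot_le
      have hqp : q.IsPrime := hq.1.1
      have h0 : q = ⊥ := by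
        refine Submodule.eq_bot_of_le_smul_of_le_jacobson_bot I _
          (IsNoetherian.noetherian _) ?_ (hIm.trans (maximalIdeal_le_jacobson _))
        intro y hy
        obtain ⟨z, rfl⟩ := Ideal.mem_span_singleton'.1 (hqI hy)
        have hz : z ∈ q := (hqp.mem_or_mem hy).resolve_right (hxn.2 q hq)
        rw [mul_comm]
        exact Ideal.mul_mem_mul (Ideal.mem_span_singleton_self x) hz
      rw [h0] at hqp
      exact IsDomain.of_bot_isPrime A
    refine ⟨hA, ?_⟩
    have hx0 : x ≠ 0 := by
      rintro rfl
      exact hxn.1 (zero_mem _)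
    obtain ⟨rs, rfl⟩ : ∃ rs : List A, rs.map (Ideal.Quotient.mk I) = rs' :=
      List.map_surjective_iff.2 Ideal.Quotient.mk_surjective rs'
    refine ⟨x :: rs, ?_, by simpa using hlen, isWeaklyRegular_cons_of_quotient
      (IsSMulRegular.of_ne_zero hx0) hreg⟩
    simp only [List.mem_cons, forall_eq_or_imp, hx, true_and]
    intro r hr
    have := hrs _ (List.mem_map_of_mem hr)
    have hloc : IsLocalHom (Ideal.Quotient.mk I) := .of_surjective _ Ideal.Quotient.mk_surjective
    rw [mem_maximalIdeal, mem_nonunits_iff] at this ⊢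
    exact fun hu => this (hu.map _)

/-- Regular local rings are Cohen–Macaulay. -/
theorem exists_isRegular_of_isRegularLocalRing (A : Type u) [CommRing A] [IsRegularLocalRing A] :
    ∃ rs : List A, (∀ r ∈ rs, r ∈ maximalIdeal A) ∧ IsRegular A rs ∧
      ringKrullDim A = rs.length := by
  obtain ⟨G, hc, hG⟩ :=
    (IsNoetherian.noetherian (maximalIdeal A)).exists_span_finset_card_eq_spanFinrank
  have h := IsRegularLocalRing.spanFinrank_maximalIdeal (R := A)
  obtain ⟨-, rs, hm, hl, hr⟩ := isDomain_and_exists_isWeaklyRegular _ A G hG hc h.le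
  exact ⟨rs, hm, .of_isWeaklyRegular_of_mem_maximalIdeal A hm hr, by rw [hl, h]⟩

end LinearConfig

/-! ### Depth and basic double links -/

namespace LinearConfig

open IsLocalRing RingTheory.Sequence CategoryTheory Abelian

universe u

/-- `DepthGE A M k`: the `A`-module `M` has depth at least `k`, expressed by the vanishing of
`Ext^i(κ, M)` for `i < k`, where `κ` is the residue field of the local ring `A`. -/
def DepthGE (A : Type u) [CommRing A] [IsLocalRing A] (M : ModuleCat.{u} A) (k : ℕ) : Prop :=
  ∀ i < k, Subsingleton (Ext.{u} (ModuleCat.of A (A ⧸ maximalIdeal A)) M i)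

section

variable {A : Type u} [CommRing A] [IsLocalRing A]

theorem DepthGE.left_of_shortExact {S : ShortComplex (ModuleCat.{u} A)} (hS : S.ShortExact)
    {k : ℕ} (h₂ : DepthGE A S.X₂ (k + 1)) (h₃ : DepthGE A S.X₃ k) : DepthGE A S.X₁ (k + 1) := by
  intro i hi
  have h2 := h₂ i hi
  cases i with
  | zero =>
    have := hS.mono_f
    exact (Ext.postcomp_mk₀_injective_of_mono (ModuleCat.of A (A ⧸ maximalIdeal A)) S.f).subsingleton
  | succ i =>
    have h3 := h₃ i (by omega)
    refine subsingleton_of_forall_eq 0 fun x => ?_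
    obtain ⟨y, rfl⟩ := Ext.covariant_sequence_exact₁ _ hS x (Subsingleton.elim _ _) rfl
    rw [Subsingleton.elim y 0, Ext.zero_comp]

theorem DepthGE.right_of_shortExact {S : ShortComplex (ModuleCat.{u} A)} (hS : S.ShortExact)
    {k : ℕ} (h₁ : DepthGE A S.X₁ (k + 1)) (h₂ : DepthGE A S.X₂ k) : DepthGE A S.X₃ k := by
  intro i hi
  have h1 := h₁ (i + 1) (by omega)
  have h2 := h₂ i hi
  refine subsingleton_of_forall_eq 0 fun x => ?_
  obtain ⟨y, rfl⟩ := Ext.covariant_sequence_exact₃ _ hS x rfl (Subsingleton.elim _ _)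
  rw [Subsingleton.elim y 0, Ext.zero_comp]

theorem DepthGE.mono {M : ModuleCat.{u} A} {k l : ℕ} (h : DepthGE A M l) (hkl : k ≤ l) :
    DepthGE A M k := fun i hi => h i (hi.trans_le hkl)

theorem DepthGE.of_linearEquiv {M N : Type u} [AddCommGroup M] [Module A M] [AddCommGroup N]
    [Module A N] (e : M ≃ₗ[A] N) {k : ℕ} (h : DepthGE A (.of A M) k) : DepthGE A (.of A N) k := by
  intro i hi
  have := h i hi
  refine subsingleton_of_forall_eq 0 fun x => ?_
  have e' := e.toModuleIso
  have : x = (x.comp (Ext.mk₀ e'.inv) (add_zero i)).comp (Ext.mk₀ e'.hom) (add_zero i) := by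
    simp
  rw [this, Subsingleton.elim (x.comp (Ext.mk₀ e'.inv) (add_zero i)) 0, Ext.zero_comp]

theorem DepthGE.of_subsingleton (M : Type u) [AddCommGroup M] [Module A M] [Subsingleton M]
    (k : ℕ) : DepthGE A (.of A M) k := by
  intro i _
  have : Limits.IsZero (ModuleCat.of A M) := ModuleCat.isZero_of_subsingleton _
  refine subsingleton_of_forall_eq 0 fun x => ?_
  have h : x = x.comp (Ext.mk₀ (𝟙 _)) (add_zero i) := by simp
  rw [h, this.eq_of_src (𝟙 (ModuleCat.of A M)) 0]
  simp

theorem DepthGE.of_isRegular [IsNoetherianRing A] (M : Type u) [AddCommGroup M] [Module A M]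
    [Module.Finite A M] [Nontrivial M]
    {rs : List A} (hm : ∀ r ∈ rs, r ∈ maximalIdeal A) (h : IsRegular M rs) :
    DepthGE A (.of A M) rs.length := by
  refine ModuleCat.subsingleton_ext_of_exists_isRegular (maximalIdeal A) _ ?_ (.of A M) ?_ rs hm h
  · rw [Module.support_eq_zeroLocus, Ideal.annihilator_quotient]
  · exact (Ne.symm (Submodule.top_ne_ideal_smul_of_le_jacobson_annihilator
      (maximalIdeal_le_jacobson _))).lt_top

theorem DepthGE.exists_isRegular [IsNoetherianRing A] (M : Type u) [AddCommGroup M] [Module A M]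
    [Module.Finite A M] [Nontrivial M] {k : ℕ} (h : DepthGE A (.of A M) k) :
    ∃ rs : List A, rs.length = k ∧ (∀ r ∈ rs, r ∈ maximalIdeal A) ∧ IsRegular M rs := by
  refine ModuleCat.exists_isRegular_of_exists_subsingleton_ext (maximalIdeal A) k (.of A M) ?_
    (.of A (A ⧸ maximalIdeal A)) ?_ h
  · exact (Ne.symm (Submodule.top_ne_ideal_smul_of_le_jacobson_annihilator
      (maximalIdeal_le_jacobson _))).lt_top
  · rw [Module.support_eq_zeroLocus, Ideal.annihilator_quotient]

/-- Depth in a basic double link: the sequences `0 → b/a → A/a → A/b → 0` and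
`0 → b/a → A/a → A/(a + x b) → 0`, whose first maps are the inclusion and multiplication by `x`,
are exact. -/
theorem DepthGE.doubleLink {a b : Ideal A} (hab : a ≤ b) {x : A}
    (hx : ∀ y, x * y ∈ a → y ∈ a) {k : ℕ} (ha : DepthGE A (.of A (A ⧸ a)) (k + 1))
    (hb : DepthGE A (.of A (A ⧸ b)) k) :
    DepthGE A (.of A (A ⧸ (a ⊔ Ideal.span {x} * b))) k := by
  let N : Submodule A (A ⧸ a) := Submodule.map a.mkQ b
  have hle : a ≤ a ⊔ Ideal.span {x} * b := le_sup_left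
  have hfac {c : Ideal A} (hc : a ≤ c) (z : A) :
      Submodule.factor hc (a.mkQ z) = 0 ↔ z ∈ c := by
    rw [Submodule.factor_mk]; exact Submodule.Quotient.mk_eq_zero c
  have hN : DepthGE A (.of A N) (k + 1) := by
    have hex : Function.Exact N.subtype (Submodule.factor hab) := by
      intro y
      obtain ⟨y, rfl⟩ := a.mkQ_surjective y
      rw [hfac hab]
      constructor
      · exact fun hy => ⟨⟨_, y, hy, rfl⟩, rfl⟩
      · rintro ⟨⟨-, z, hz, rfl⟩, h⟩
        have : z - y ∈ a := (Submodule.Quotient.eq a).1 h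
        simpa using b.sub_mem hz (hab this)
    let S := ShortComplex.mk (ModuleCat.ofHom N.subtype) (ModuleCat.ofHom (Submodule.factor hab))
      (by ext y; exact hex.apply_apply_eq_zero y)
    have hS : S.ShortExact := ModuleCat.shortComplex_shortExact S hex
      N.subtype_injective (Submodule.factor_surjective hab)
    exact DepthGE.left_of_shortExact hS ha hb
  let f : N →ₗ[A] (A ⧸ a) := (LinearMap.lsmul A (A ⧸ a) x).comp N.subtype
  have hex : Function.Exact f (Submodule.factor hle) := by
    intro y
    obtain ⟨y, rfl⟩ := a.mkQ_surjective y
    rw [hfac]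
    constructor
    · intro hy
      obtain ⟨u, hu, v, hv, rfl⟩ := Submodule.mem_sup.1 hy
      obtain ⟨w, hw, rfl⟩ := Ideal.mem_span_singleton_mul.1 hv
      refine ⟨⟨_, w, hw, rfl⟩, ((Submodule.Quotient.eq a).2 ?_ : a.mkQ (x * w) = _)⟩
      simpa using hu
    · rintro ⟨⟨-, w, hw, rfl⟩, h⟩
      have : x * w - y ∈ a := (Submodule.Quotient.eq a).1 h
      have h2 := Submodule.sub_mem _
        (Ideal.mem_sup_right (S := a) (Ideal.mul_mem_mul (Ideal.mem_span_singleton_self x) hw))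
        (Ideal.mem_sup_left (T := Ideal.span {x} * b) this)
      simpa using h2
  have hf : Function.Injective f := by
    rw [injective_iff_map_eq_zero]
    rintro ⟨-, w, hw, rfl⟩ h
    have h' : x * w ∈ a := (Submodule.Quotient.mk_eq_zero a).1 h
    exact Subtype.ext ((Submodule.Quotient.mk_eq_zero a).2 (hx w h'))
  let S := ShortComplex.mk (ModuleCat.ofHom f) (ModuleCat.ofHom (Submodule.factor hle))
      (by ext y; exact hex.apply_apply_eq_zero y)
  have hS : S.ShortExact := ModuleCat.shortComplex_shortExact S hex hf
    (Submodule.factor_surjective hle)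
  exact DepthGE.right_of_shortExact hS hN (ha.mono (Nat.le_succ k))

end

/-- `CMDepth I c`: at every prime `p`, the localization of `R/I` has depth at least `ht p - c`. -/
def CMDepth {R : Type u} [CommRing R] (I : Ideal R) (c : ℕ) : Prop :=
  ∀ (p : Ideal R) [p.IsPrime] (k : ℕ), ((k + c : ℕ) : ℕ∞) ≤ p.height →
    DepthGE (Localization.AtPrime p)
      (.of _ (Localization.AtPrime p ⧸ I.map (algebraMap R (Localization.AtPrime p)))) k

theorem CMDepth.bot {R : Type u} [CommRing R] [IsRegularRing R] : CMDepth (⊥ : Ideal R) 0 := by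
  intro p _ k hk
  have := IsRegularRing.isRegularLocalRing_localization p
  obtain ⟨rs, hm, hr, hd⟩ := exists_isRegular_of_isRegularLocalRing (Localization.AtPrime p)
  have h := DepthGE.of_isRegular _ hm hr
  rw [IsLocalization.AtPrime.ringKrullDim_eq_height p] at hd
  rw [Ideal.map_bot]
  refine (h.of_linearEquiv (Submodule.quotEquivOfEqBot ⊥ rfl).symm).mono ?_
  have hd' : p.height = rs.length := by exact_mod_cast hd
  rw [hd'] at hk
  exact_mod_cast hk

theorem CMDepth.top {R : Type u} [CommRing R] (c : ℕ) : CMDepth (⊤ : Ideal R) c := by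
  intro p _ k hk
  rw [Ideal.map_top]
  exact DepthGE.of_subsingleton _ k

theorem CMDepth.doubleLink {R : Type u} [CommRing R] {a b : Ideal R} (hab : a ≤ b) {x : R}
    (hx : ∀ y, x * y ∈ a → y ∈ a) {c : ℕ} (ha : CMDepth a c) (hb : CMDepth b (c + 1)) :
    CMDepth (a ⊔ Ideal.span {x} * b) (c + 1) := by
  intro p _ k hk
  rw [Ideal.map_sup, Ideal.map_mul, Ideal.map_span, Set.image_singleton]
  refine DepthGE.doubleLink (Ideal.map_mono hab) ?_ (ha p (k + 1) ?_) (hb p k hk)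
  · intro y hy
    obtain ⟨⟨z, s⟩, hz⟩ := IsLocalization.surj p.primeCompl y
    have h1 : algebraMap R (Localization.AtPrime p) (x * z) ∈
        a.map (algebraMap R (Localization.AtPrime p)) := by
      rw [map_mul, ← hz, ← mul_assoc]
      exact Ideal.mul_mem_right _ _ hy
    obtain ⟨m, hm, h2⟩ := (IsLocalization.algebraMap_mem_map_algebraMap_iff p.primeCompl _ _ _).1 h1
    have h3 : m * z ∈ a := hx _ (by convert h2 using 1; ring)
    refine (Ideal.mul_unit_mem_iff_mem _ (IsLocalization.map_units _ s)).1 ?_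
    rw [hz]
    exact (IsLocalization.algebraMap_mem_map_algebraMap_iff p.primeCompl _ _ _).2 ⟨m, hm, h3⟩
  · convert hk using 2; ring

theorem IsCMLocalRing.of_ringEquiv {A B : Type*} [CommRing A] [IsLocalRing A] [CommRing B]
    [IsLocalRing B] (e : A ≃+* B) (h : IsCMLocalRing A) : IsCMLocalRing B := by
  obtain ⟨hn, rs, hm, hr, hd⟩ := h
  refine ⟨isNoetherianRing_of_ringEquiv A e, rs.map e, ?_, ?_, ?_⟩
  · intro r hr
    obtain ⟨s, hs, rfl⟩ := List.mem_map.1 hr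
    have := hm s hs
    rw [mem_maximalIdeal, mem_nonunits_iff] at this ⊢
    simpa using this
  · refine (AddEquiv.isRegular_congr (e := e.toAddEquiv) (as := rs) ?_).1 hr
    rw [List.forall₂_map_right_iff, List.forall₂_same]
    intro r _ y
    simp
  · rw [← ringKrullDim_eq_of_ringEquiv e, hd, List.length_map]

/-- If `I` has height at least `c`, then `(R/I)_p` has dimension at most `ht p - c`, so a regular
sequence of length `ht p - c` has the length of the dimension. -/
theorem CMDepth.isCMRing {R : Type u} [CommRing R] [IsNoetherianRing R] {I : Ideal R} {c : ℕ}
    (hI : CMDepth I c) (hc : (c : ℕ∞) ≤ I.height) : IsCMRing (R ⧸ I) := by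
  refine ⟨inferInstance, fun q _ => ?_⟩
  let p := q.comap (Ideal.Quotient.mk I)
  have hIp : I ≤ p := by
    intro x hx
    simp [p, Ideal.mem_comap, Ideal.Quotient.eq_zero_iff_mem.2 hx]
  let S := Localization.AtPrime p
  let j := I.map (algebraMap R S)
  have hj : j ≤ maximalIdeal S := by
    rw [← Localization.AtPrime.map_eq_maximalIdeal]
    exact Ideal.map_mono hIp
  have : Nontrivial (S ⧸ j) := Ideal.Quotient.nontrivial_iff.2
    (ne_top_of_le_ne_top Ideal.IsPrime.ne_top' hj)
  have : IsLocalRing (S ⧸ j) := IsLocalRing.of_surjective' _ Ideal.Quotient.mk_surjective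
  have hsub : Algebra.algebraMapSubmonoid (R ⧸ I) p.primeCompl = q.primeCompl := by
    ext x
    obtain ⟨x, rfl⟩ := Ideal.Quotient.mk_surjective x
    constructor
    · rintro ⟨y, hy, h⟩
      rw [← h]; exact hy
    · exact fun hx => ⟨x, hx, rfl⟩
  have hloc : IsLocalization q.primeCompl (S ⧸ j) := by
    rw [← hsub]; infer_instance
  refine IsCMLocalRing.of_ringEquiv
    (IsLocalization.algEquiv q.primeCompl (S ⧸ j) (Localization.AtPrime q)).toRingEquiv ?_
  obtain ⟨h, hh⟩ := ENat.ne_top_iff_exists.1 (Ideal.height_ne_top (I := p) Ideal.IsPrime.ne_top')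
  have hch : c ≤ h := by
    have := hc.trans (Ideal.height_mono hIp)
    rw [← hh] at this
    exact_mod_cast this
  obtain ⟨rs, hlen, hm, hr⟩ :=
    (hI p (h - c) (by rw [← hh, Nat.sub_add_cancel hch])).exists_isRegular
  have hm' : ∀ r ∈ rs.map (Ideal.Quotient.mk j), r ∈ maximalIdeal (S ⧸ j) := by
    intro r hr
    obtain ⟨s, hs, rfl⟩ := List.mem_map.1 hr
    have hloc : IsLocalHom (Ideal.Quotient.mk j) := .of_surjective _ Ideal.Quotient.mk_surjective
    rw [← Ideal.mem_comap, IsLocalRing.maximalIdeal_comap]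
    exact hm s hs
  have hr' : IsRegular (S ⧸ j) (rs.map (Ideal.Quotient.mk j)) :=
    .of_isWeaklyRegular_of_mem_maximalIdeal _ hm'
      ((isWeaklyRegular_map_algebraMap_iff (S ⧸ j) (S ⧸ j) rs).2 hr.1)
  refine ⟨inferInstance, _, hm', hr', ?_⟩
  rw [List.length_map, hlen]
  refine le_antisymm ?_ ?_
  · have hjc : (c : ℕ∞) ≤ j.height := by
      rw [Ideal.height_eq_inf_minimalPrimes j]
      refine le_iInf₂ fun Q hQ => ?_
      have hQp : Q.IsPrime := hQ.1.1
      rw [← IsLocalization.height_under p.primeCompl Q]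
      exact hc.trans (Ideal.height_mono (Ideal.map_le_iff_le_comap.1 hQ.1.2))
    have h1 := height_add_ringKrullDim_quotient_le j
    rw [IsLocalization.AtPrime.ringKrullDim_eq_height p S, ← hh] at h1
    have h2 : ((c : ℕ) : WithBot ℕ∞) + ringKrullDim (S ⧸ j) ≤
        (c : ℕ) + ((h - c : ℕ) : WithBot ℕ∞) := by
      rw [← Nat.cast_add, Nat.add_sub_cancel' hch]
      exact le_trans (add_le_add_left (by exact_mod_cast hjc) _) h1
    exact (ENat.WithBot.add_le_add_natCast_left_iff).1 h2
  · have h1 := ringKrullDim_add_length_eq_ringKrullDim_of_isRegular _ hr'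
    rw [← h1, List.length_map, hlen]
    have : Nontrivial ((S ⧸ j) ⧸ Ideal.ofList (rs.map (Ideal.Quotient.mk j))) :=
      Ideal.Quotient.nontrivial_iff.2 fun h => hr'.2 (by simp [h])
    exact le_add_of_nonneg_left ringKrullDim_nonneg_of_nontrivial

end LinearConfig

/-! ### Ideals generated by linear forms -/

namespace LinearConfig

open MvPolynomial

theorem eq_natCast_sub_of_add_le {x : WithBot ℕ∞} {a b : ℕ} (h₁ : x + a ≤ b) (h₂ : b ≤ x + a) :
    x = ((b - a : ℕ) : WithBot ℕ∞) := by
  have h : x + a = b := le_antisymm h₁ h₂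
  induction x with
  | bot => simp at h
  | coe x =>
    induction x with
    | top =>
      have h' : (⊤ : ℕ∞) + a = b := WithBot.coe_injective h
      rw [top_add] at h'
      exact absurd h'.symm (ENat.natCast_ne_top b)
    | coe x =>
      have : x + a = b := by exact_mod_cast h
      rw [← this, Nat.add_sub_cancel]; rfl

section

variable {K : Type*} [Field K] {σ : Type*}

/-- The quotient by a set `T` of linear forms embeds into the polynomial ring: the endomorphism
sending each variable to its projection along the linear span of `T` has kernel `(T)`. -/
theorem exists_algHom_ker_eq_span {T : Set (MvPolynomial σ K)}
    (hT : ∀ f ∈ T, f.IsHomogeneous 1) :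
    ∃ φ : MvPolynomial σ K →ₐ[K] MvPolynomial σ K, RingHom.ker φ = Ideal.span T ∧
      ∀ l : MvPolynomial σ K, l.IsHomogeneous 1 → φ l = 0 → l ∈ Submodule.span K T := by
  obtain ⟨W', hW⟩ := Submodule.exists_isCompl (Submodule.span K T)
  let π : MvPolynomial σ K →ₗ[K] MvPolynomial σ K := W'.projection (Submodule.span K T) hW.symm
  let φ : MvPolynomial σ K →ₐ[K] MvPolynomial σ K := aeval fun i => π (X i)
  have hφ : ∀ l : MvPolynomial σ K, l.IsHomogeneous 1 → φ l = π l := by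
    intro l hl
    have : l ∈ Submodule.span K (Set.range (X : σ → MvPolynomial σ K)) := by
      rw [← homogeneousSubmodule_one_eq_span_X]; exact hl
    exact LinearMap.eqOn_span (f := φ.toLinearMap) (g := π)
      (by rintro _ ⟨i, rfl⟩; simp [φ]) this
  have hπ : ∀ l, π l = 0 ↔ l ∈ Submodule.span K T := fun l =>
    Submodule.projection_apply_eq_zero_iff hW.symm
  have hsub : ∀ l, l - φ l ∈ Ideal.span T := by
    intro l
    have h : (Ideal.Quotient.mkₐ K (Ideal.span T)).comp φ =
        Ideal.Quotient.mkₐ K (Ideal.span T) := by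
      refine MvPolynomial.algHom_ext fun i => ?_
      rw [AlgHom.comp_apply, aeval_X, ← sub_eq_zero, ← map_sub, Ideal.Quotient.mkₐ_eq_mk,
        Ideal.Quotient.eq_zero_iff_mem, ← Ideal.neg_mem_iff, neg_sub]
      have := Submodule.span_le_restrictScalars K (MvPolynomial σ K) _
        (Submodule.sub_projection_mem hW.symm (X i))
      simpa using this
    rw [← Ideal.Quotient.eq_zero_iff_mem, map_sub, sub_eq_zero]
    exact (DFunLike.congr_fun h l).symm
  refine ⟨φ, le_antisymm ?_ ?_, fun l hl h => (hπ l).1 (hφ l hl ▸ h)⟩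
  · intro l hl
    have := hsub l
    rwa [(RingHom.mem_ker).1 hl, sub_zero] at this
  · rw [Ideal.span_le]
    intro l hl
    exact (RingHom.mem_ker).2 ((hφ l (hT l hl)).trans ((hπ l).2 (Submodule.subset_span hl)))

theorem isPrime_span_of_linear {T : Set (MvPolynomial σ K)} (hT : ∀ f ∈ T, f.IsHomogeneous 1) :
    (Ideal.span T).IsPrime := by
  obtain ⟨φ, h, -⟩ := exists_algHom_ker_eq_span hT
  rw [← h]
  exact RingHom.ker_isPrime φ

theorem mem_span_of_mem_ideal_span {T : Set (MvPolynomial σ K)}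
    (hT : ∀ f ∈ T, f.IsHomogeneous 1) {l : MvPolynomial σ K} (hl : l.IsHomogeneous 1)
    (h : l ∈ Ideal.span T) : l ∈ Submodule.span K T := by
  obtain ⟨φ, hφ, h'⟩ := exists_algHom_ker_eq_span hT
  rw [← hφ] at h
  exact h' l hl h

variable {ι : Type*} {F : ι → MvPolynomial σ K}

theorem notMem_span_image {s : Finset ι} {a : ι} (ha : a ∉ s)
    (hF : ∀ b ∈ insert a (s : Set ι), (F b).IsHomogeneous 1)
    (h : LinearIndepOn K F (insert a (s : Set ι))) : F a ∉ Ideal.span (F '' s) := by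
  intro hmem
  have := mem_span_of_mem_ideal_span (by rintro _ ⟨b, hb, rfl⟩; exact hF b (Or.inr hb))
    (hF a (Or.inl rfl)) hmem
  rw [linearIndepOn_insert (by simpa using ha)] at h
  exact h.2 this

/-- The linear ideals generated by the initial parts of the sequence form a chain of distinct primes.
-/
theorem card_le_height_span_image (s : Finset ι) (hF : ∀ a ∈ s, (F a).IsHomogeneous 1)
    (h : LinearIndepOn K F (s : Set ι)) : (s.card : ℕ∞) ≤ (Ideal.span (F '' s)).height := by
  classical
  induction s using Finset.induction_on with
  | empty => simp
  | insert a s ha ih =>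
    have hs := ih (fun b hb => hF b (Finset.mem_insert_of_mem hb))
      (h.mono (by simp))
    have hp : (Ideal.span (F '' s)).IsPrime := isPrime_span_of_linear (by
      rintro _ ⟨b, hb, rfl⟩; exact hF b (Finset.mem_insert_of_mem hb))
    have hp' : (Ideal.span (F '' (insert a s : Finset ι))).IsPrime := isPrime_span_of_linear (by
      rintro _ ⟨b, hb, rfl⟩; exact hF b hb)
    have hlt : Ideal.span (F '' s) < Ideal.span (F '' (insert a s : Finset ι)) := by
      refine lt_of_le_not_ge (Ideal.span_mono (Set.image_mono (by simp))) fun hle => ?_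
      refine notMem_span_image ha (by simpa using hF) (by simpa using h) (hle (Ideal.subset_span ?_))
      exact ⟨a, by simp, rfl⟩
    rw [Finset.card_insert_of_notMem ha, Nat.cast_add, Nat.cast_one]
    exact (add_le_add_left hs 1).trans (Ideal.height_add_one_le_of_lt_of_isPrime hlt)

variable [Finite σ]

theorem span_image_height_le (s : Finset ι) (hF : ∀ a ∈ s, (F a).IsHomogeneous 1) :
    (Ideal.span (F '' s)).height ≤ s.card := by
  classical
  have hp : (Ideal.span (F '' s)).IsPrime := isPrime_span_of_linear (by simpa using hF)
  rw [← Finset.coe_image] at hp ⊢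
  refine (Ideal.height_le_spanFinrank _ hp.ne_top).trans ?_
  have h2 := Submodule.spanFinrank_span_le_ncard_of_finite (R := MvPolynomial σ K)
    (Finset.finite_toSet (s.image F))
  rw [Set.ncard_coe_finset] at h2
  exact_mod_cast h2.trans Finset.card_image_le

/-- A linearly dependent set of forms has a redundant generator, against Krull's height theorem. -/
theorem linearIndepOn_of_card_le_height (s : Finset ι) (hF : ∀ a ∈ s, (F a).IsHomogeneous 1)
    (h : (s.card : ℕ∞) ≤ (Ideal.span (F '' s)).height) : LinearIndepOn K F (s : Set ι) := by
  classical
  rw [linearIndepOn_iff_notMem_span]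
  intro a ha hmem
  have hle : Ideal.span (F '' s) ≤ Ideal.span (F '' (s.erase a : Finset ι)) := by
    rw [Ideal.span_le]
    rintro _ ⟨b, hb, rfl⟩
    by_cases hba : b = a
    · subst hba
      have := Submodule.span_le_restrictScalars K (MvPolynomial σ K) _ hmem
      simpa using this
    · exact Ideal.subset_span ⟨b, by simp [hba]; exact hb, rfl⟩
  have h1 := (h.trans (Ideal.height_mono hle)).trans
    (span_image_height_le (s.erase a) fun b hb => hF b (Finset.mem_of_mem_erase hb))
  have h2 := Finset.card_erase_lt_of_mem ha
  have h3 : s.card ≤ (s.erase a).card := by exact_mod_cast h1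
  omega

/-- The ideal of the variables has height `card σ` and contains all linear forms. -/
theorem natCard_le_ringKrullDim_quotient_add (s : Finset ι)
    (hF : ∀ a ∈ s, (F a).IsHomogeneous 1) : (Nat.card σ : WithBot ℕ∞) ≤
      ringKrullDim (MvPolynomial σ K ⧸ Ideal.span (F '' s)) + s.card := by
  have := Fintype.ofFinite σ
  have hX : ∀ a ∈ (Finset.univ : Finset σ), (X a : MvPolynomial σ K).IsHomogeneous 1 :=
    fun a _ => isHomogeneous_X K a
  have hp : (Ideal.span ((X : σ → MvPolynomial σ K) '' (Finset.univ : Finset σ))).IsPrime :=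
    isPrime_span_of_linear (by simpa using hX)
  have h1 := card_le_height_span_image (Finset.univ : Finset σ) hX
    ((linearIndependent_X σ K).linearIndepOn _)
  have hsub : F '' s ⊆ Ideal.span ((X : σ → MvPolynomial σ K) '' (Finset.univ : Finset σ)) := by
    rintro _ ⟨a, ha, rfl⟩
    have h : F a ∈ Submodule.span K (Set.range (X : σ → MvPolynomial σ K)) := by
      rw [← homogeneousSubmodule_one_eq_span_X]; exact hF a ha
    have := Submodule.span_le_restrictScalars K (MvPolynomial σ K) _ h
    simpa using this
  have h2 := Ideal.height_le_ringKrullDim_quotient_add_encard _ hsub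
  have h3 : ((F '' s).encard : WithBot ℕ∞) ≤ s.card := by
    have := Set.encard_image_le F (s : Set ι)
    rw [Set.encard_coe_eq_coe_finsetCard] at this
    exact_mod_cast this
  rw [Nat.card_eq_fintype_card, ← Finset.card_univ]
  exact (by exact_mod_cast h1 : _ ≤ _).trans (h2.trans (add_le_add_right h3 _))

theorem ringKrullDim_quotient_add_le {I : Ideal (MvPolynomial σ K)} {m : ℕ}
    (h : (m : ℕ∞) ≤ I.height) :
    ringKrullDim (MvPolynomial σ K ⧸ I) + m ≤ Nat.card σ := by
  have h1 := height_add_ringKrullDim_quotient_le I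
  rw [MvPolynomial.ringKrullDim_of_isNoetherianRing, ringKrullDim_eq_zero_of_field, zero_add] at h1
  refine le_trans ?_ h1
  rw [add_comm]
  exact add_le_add_left (by exact_mod_cast h) _

theorem ringKrullDim_quotient_span_image (s : Finset ι) (hF : ∀ a ∈ s, (F a).IsHomogeneous 1)
    (h : LinearIndepOn K F (s : Set ι)) :
    ringKrullDim (MvPolynomial σ K ⧸ Ideal.span (F '' s)) =
      ((Nat.card σ - s.card : ℕ) : WithBot ℕ∞) := by
  have hle := ringKrullDim_quotient_add_le (card_le_height_span_image s hF h)
  have hge := natCard_le_ringKrullDim_quotient_add s hF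
  exact eq_natCast_sub_of_add_le hle hge

end

end LinearConfig

/-! ### Alternating index sets and basic double links -/

namespace LinearConfig

open MvPolynomial

universe u

/-- The index sets of the components of `Z_{c,t}` when the forms are listed as
`M_0, L_0, M_1, L_1, …`: the sets `{j_0 < ⋯ < j_{c-1}}` with `j_k = 2 m_k + k` and
`0 ≤ m_0 ≤ m_1 ≤ ⋯ ≤ t`. -/
def altSets (c t : ℕ) : Set (Finset ℕ) :=
  {s | ∃ m : ℕ → ℕ, Monotone m ∧ (∀ k, m k ≤ t) ∧ s = (Finset.range c).image fun k => 2 * m k + k}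

theorem altSets_zero (t : ℕ) : altSets 0 t = {∅} := by
  ext s
  simp only [altSets, Set.mem_ofPred_eq, Finset.range_zero, Finset.image_empty, Set.mem_singleton_iff]
  exact ⟨fun ⟨_, _, _, h⟩ => h, fun h => ⟨fun _ => 0, monotone_const, fun _ => Nat.zero_le _, h⟩⟩

theorem insert_mem_altSets {c t : ℕ} {s : Finset ℕ} (hs : s ∈ altSets c t) :
    insert (2 * t + c) s ∈ altSets (c + 1) t := by
  obtain ⟨m, hm, hle, rfl⟩ := hs
  refine ⟨fun k => if k < c then m k else t, ?_, ?_, ?_⟩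
  · intro a b hab
    dsimp only
    split_ifs
    · exact hm hab
    · exact hle _
    · omega
    · rfl
  · intro k
    dsimp only
    split_ifs
    · exact hle _
    · rfl
  · rw [Finset.range_add_one, Finset.image_insert]
    simp only [lt_irrefl, if_false]
    congr 1
    refine Finset.image_congr fun k hk => ?_
    simp only [Finset.coe_range, Set.mem_Iio] at hk
    simp [hk]

theorem altSets_mono {c t t' : ℕ} (h : t ≤ t') : altSets c t ⊆ altSets c t' := by
  rintro s ⟨m, hm, hle, rfl⟩
  exact ⟨m, hm, fun k => (hle k).trans h, rfl⟩

theorem altSets_succ_zero (c : ℕ) :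
    altSets (c + 1) 0 = insert c '' altSets c 0 := by
  ext s
  constructor
  · rintro ⟨m, hm, hle, rfl⟩
    refine ⟨_, ⟨m, hm, hle, rfl⟩, ?_⟩
    rw [Finset.range_add_one, Finset.image_insert, Nat.le_zero.1 (hle c)]
    simp
  · rintro ⟨s, hs, rfl⟩
    simpa using insert_mem_altSets hs

theorem altSets_succ_succ (c t : ℕ) :
    altSets (c + 1) (t + 1) =
      insert (2 * (t + 1) + c) '' altSets c (t + 1) ∪ altSets (c + 1) t := by
  ext s
  constructor
  · rintro ⟨m, hm, hle, rfl⟩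
    rcases (hle c).lt_or_eq with h | h
    · right
      refine ⟨fun k => min (m k) t, fun a b hab => min_le_min_right _ (hm hab),
        fun k => min_le_right _ _, Finset.image_congr fun k hk => ?_⟩
      simp only [Finset.coe_range, Set.mem_Iio] at hk
      have : m k ≤ t := (hm (Nat.lt_succ_iff.1 hk)).trans (Nat.lt_succ_iff.1 h)
      simp [this]
    · left
      refine ⟨_, ⟨m, hm, hle, rfl⟩, ?_⟩
      rw [Finset.range_add_one, Finset.image_insert, h]
  · rintro (⟨s, hs, rfl⟩ | hs)
    · exact insert_mem_altSets hs
    · exact altSets_mono (Nat.le_succ t) hs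

theorem exists_subset_of_mem_altSets_succ {c t : ℕ} {s : Finset ℕ} (hs : s ∈ altSets (c + 1) t) :
    ∃ s' ∈ altSets c (t + 1), s' ⊆ s := by
  obtain ⟨m, hm, hle, rfl⟩ := hs
  exact ⟨_, ⟨m, hm, fun k => (hle k).trans (Nat.le_succ t), rfl⟩,
    Finset.image_subset_image (Finset.range_subset_range.2 (Nat.le_succ c))⟩

theorem subset_range_of_mem_altSets {c t : ℕ} {s : Finset ℕ} (hs : s ∈ altSets c t) :
    s ⊆ Finset.range (2 * t + c) := by
  obtain ⟨m, hm, hle, rfl⟩ := hs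
  intro x hx
  obtain ⟨k, hk, rfl⟩ := Finset.mem_image.1 hx
  have := hle k
  rw [Finset.mem_range] at hk ⊢
  omega

theorem card_of_mem_altSets {c t : ℕ} {s : Finset ℕ} (hs : s ∈ altSets c t) : s.card = c := by
  obtain ⟨m, hm, hle, rfl⟩ := hs
  rw [Finset.card_image_of_injective, Finset.card_range]
  refine StrictMono.injective fun a b hab => ?_
  have := hm hab.le
  omega

theorem altSets_finite (c t : ℕ) : (altSets c t).Finite :=
  (Finset.finite_toSet (Finset.range (2 * t + c)).powerset).subset fun _ hs =>
    Finset.mem_coe.2 (Finset.mem_powerset.2 (subset_range_of_mem_altSets hs))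

theorem altSets_nonempty (c t : ℕ) : (altSets c t).Nonempty :=
  ⟨_, fun _ => 0, monotone_const, fun _ => Nat.zero_le _, rfl⟩

section

variable {R : Type u} [CommRing R]

/-- The intersection of the ideals `(F_j : j ∈ s)` over the alternating index sets `s`. -/
noncomputable def altInf (F : ℕ → R) (c t : ℕ) : Ideal R :=
  ⨅ s ∈ altSets c t, Ideal.span (F '' (s : Set ℕ))

/-- Any at most `q` of the elements `F_0, …, F_{N-1}` generate a prime ideal, and they do so
irredundantly. -/
structure IsGeneric (F : ℕ → R) (N q : ℕ) : Prop where
  isPrime : ∀ s : Finset ℕ, s ⊆ Finset.range N → s.card ≤ q →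
    (Ideal.span (F '' (s : Set ℕ))).IsPrime
  notMem : ∀ s : Finset ℕ, s ⊆ Finset.range N → s.card < q → ∀ a < N, a ∉ s →
    F a ∉ Ideal.span (F '' (s : Set ℕ))

variable {F : ℕ → R}

theorem IsGeneric.mono {N N' q q' : ℕ} (h : IsGeneric F N q) (hN : N' ≤ N) (hq : q' ≤ q) :
    IsGeneric F N' q' where
  isPrime s hs hc := h.isPrime s (hs.trans (Finset.range_subset_range.2 hN)) (hc.trans hq)
  notMem s hs hc a ha has := h.notMem s (hs.trans (Finset.range_subset_range.2 hN))
    (hc.trans_le hq) a (ha.trans_le hN) has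

theorem span_image_insert (s : Finset ℕ) (a : ℕ) :
    Ideal.span (F '' (insert a s : Finset ℕ)) =
      Ideal.span (F '' (s : Set ℕ)) ⊔ Ideal.span {F a} := by
  rw [Finset.coe_insert, Set.image_insert_eq, Ideal.span_insert, sup_comm]

theorem comap_span_quotient (s : Finset ℕ) (a : ℕ) :
    (Ideal.span ((fun j => Ideal.Quotient.mk (Ideal.span {F a}) (F j)) '' (s : Set ℕ))).comap
      (Ideal.Quotient.mk (Ideal.span {F a})) = Ideal.span (F '' (insert a s : Finset ℕ)) := by
  rw [span_image_insert, ← Set.image_image, ← Ideal.map_span,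
    Ideal.comap_map_of_surjective' _ Ideal.Quotient.mk_surjective, Ideal.mk_ker]

theorem IsGeneric.quotient {N q : ℕ} (h : IsGeneric F (N + 1) (q + 1)) :
    IsGeneric (fun j => Ideal.Quotient.mk (Ideal.span {F N}) (F j)) N q where
  isPrime s hs hc := by
    have hp := h.isPrime (insert N s)
      (by rw [Finset.range_add_one]; exact Finset.insert_subset_insert _ hs)
      ((Finset.card_insert_le _ _).trans (Nat.succ_le_succ hc))
    rw [← comap_span_quotient] at hp
    rw [← Ideal.map_comap_of_surjective _ Ideal.Quotient.mk_surjective (Ideal.span _)]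
    exact Ideal.map_isPrime_of_surjective Ideal.Quotient.mk_surjective (Ideal.comap_mono bot_le)
  notMem s hs hc a ha has := by
    rw [← Ideal.mem_comap, comap_span_quotient]
    refine h.notMem _ (by rw [Finset.range_add_one]; exact Finset.insert_subset_insert _ hs)
      ((Finset.card_insert_le _ _).trans_lt (Nat.succ_lt_succ hc)) a (by omega) ?_
    rw [Finset.mem_insert, not_or]
    exact ⟨by omega, has⟩

theorem mem_altInf {c t : ℕ} {x : R} :
    x ∈ altInf F c t ↔ ∀ s ∈ altSets c t, x ∈ Ideal.span (F '' (s : Set ℕ)) := by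
  simp [altInf]

/-- An element beyond the range of the index sets is a nonzerodivisor modulo the intersection. -/
theorem IsGeneric.mem_altInf_of_mul_mem {N c t a : ℕ} (h : IsGeneric F N (c + 1))
    (ha : a < N) (hat : 2 * t + c ≤ a) {y : R}
    (hy : F a * y ∈ altInf F c t) : y ∈ altInf F c t := by
  rw [mem_altInf] at hy ⊢
  intro s hs
  have hr := subset_range_of_mem_altSets hs
  have hr' : s ⊆ Finset.range N := hr.trans (Finset.range_subset_range.2 (hat.trans ha.le))
  have hc := card_of_mem_altSets hs
  refine ((h.isPrime s hr' (by omega)).mem_or_mem (hy s hs)).resolve_left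
    (h.notMem s hr' (by omega) a ha fun h => ?_)
  have := Finset.mem_range.1 (hr h)
  omega

theorem altInf_zero (t : ℕ) : altInf F 0 t = ⊥ := by
  simp [altInf, altSets_zero]

theorem altSets_zero_right (c : ℕ) : altSets c 0 = {Finset.range c} := by
  induction c with
  | zero => simp [altSets_zero]
  | succ c ih => rw [altSets_succ_zero, ih, Set.image_singleton, Finset.range_add_one]

theorem altInf_zero_right (c : ℕ) :
    altInf F c 0 = Ideal.span (F '' (Finset.range c : Finset ℕ)) := by
  simp [altInf, altSets_zero_right]

theorem altInf_succ_zero (c : ℕ) :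
    altInf F (c + 1) 0 = altInf F c 0 ⊔ Ideal.span {F c} := by
  rw [altInf_zero_right, altInf_zero_right, Finset.range_add_one, span_image_insert]

theorem altInf_le_altInf_succ (c t : ℕ) : altInf F c (t + 1) ≤ altInf F (c + 1) t := by
  intro x hx
  rw [mem_altInf] at hx ⊢
  intro s hs
  obtain ⟨s', hs', hsub⟩ := exists_subset_of_mem_altSets_succ hs
  exact Ideal.span_mono (Set.image_mono hsub) (hx s' hs')

/-- The ideals obtained from `0` by successive basic double links. -/
noncomputable def linkIdeal (F : ℕ → R) : ℕ → ℕ → Ideal R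
  | 0, _ => ⊥
  | c + 1, 0 => linkIdeal F c 0 ⊔ Ideal.span {F c}
  | c + 1, t + 1 =>
    linkIdeal F c (t + 1) ⊔ Ideal.span {F (2 * (t + 1) + c)} * linkIdeal F (c + 1) t

theorem map_linkIdeal {S : Type*} [CommRing S] (φ : R →+* S) (F : ℕ → R) (c t : ℕ) :
    (linkIdeal F c t).map φ = linkIdeal (fun j => φ (F j)) c t := by
  induction c, t using linkIdeal.induct with
  | case1 t => simp [linkIdeal, Ideal.map_bot]
  | case2 c ih => simp [linkIdeal, Ideal.map_sup, ih, Ideal.map_span]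
  | case3 c t ih₁ ih₂ =>
    rw [linkIdeal, linkIdeal, Ideal.map_sup, Ideal.map_mul, ih₁, ih₂, Ideal.map_span,
      Set.image_singleton]

end

/-- The intersection ideals arise by basic double links. The point is that cutting
`altInf F c (t + 1)` with the next element `F_a` again gives an intersection of prime ideals:
modulo `F_a` this is the same statement for fewer elements. -/
theorem altInf_eq_linkIdeal (c : ℕ) : ∀ (t : ℕ) {R : Type u} [CommRing R] (F : ℕ → R),
    IsGeneric F (2 * t + c) (c + 1) → altInf F c t = linkIdeal F c t := by
  induction c with
  | zero => intro t R _ F _; rw [altInf_zero, linkIdeal]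
  | succ c ihc =>
    intro t
    induction t with
    | zero =>
      intro R _ F h
      rw [altInf_succ_zero, linkIdeal, ihc 0 F (h.mono (by omega) (by omega))]
    | succ t iht =>
      intro R _ F h
      have hA := ihc (t + 1) F (h.mono (by omega) (by omega))
      have hB := iht F (h.mono (by omega) le_rfl)
      rw [linkIdeal, ← hA, ← hB]
      set a := 2 * (t + 1) + c with ha
      have hbar := ihc (t + 1) _ (h.quotient (N := a) (q := c + 1))
      rw [← map_linkIdeal, ← hA] at hbar
      -- the section by `F a` is the intersection of the sections of the components
      have hsec : ∀ x, (∀ s ∈ altSets c (t + 1), x ∈ Ideal.span (F '' (insert a s : Finset ℕ))) →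
          x ∈ altInf F c (t + 1) ⊔ Ideal.span {F a} := by
        intro x hx
        rw [← Ideal.mk_ker (I := Ideal.span {F a}),
          ← Ideal.comap_map_of_surjective' _ Ideal.Quotient.mk_surjective, ← hbar, Ideal.mem_comap,
          mem_altInf]
        intro s hs
        rw [← Ideal.mem_comap, comap_span_quotient]
        exact hx s hs
      have hAB := altInf_le_altInf_succ (F := F) c t
      refine le_antisymm (fun x hx => ?_) (sup_le ?_ ?_)
      · rw [mem_altInf, altSets_succ_succ] at hx
        obtain ⟨u, hu, v, hv, rfl⟩ := Submodule.mem_sup.1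
          (hsec x fun s hs => hx _ (Or.inl ⟨s, hs, rfl⟩))
        obtain ⟨w, rfl⟩ := Ideal.mem_span_singleton.1 hv
        have hxB : u + F a * w ∈ altInf F (c + 1) t :=
          mem_altInf.2 fun s hs => hx s (Or.inr hs)
        have hwB : F a * w ∈ altInf F (c + 1) t := by
          simpa using Ideal.sub_mem _ hxB (hAB hu)
        refine Submodule.add_mem_sup hu (Ideal.mul_mem_mul (Ideal.mem_span_singleton_self _) ?_)
        exact h.mem_altInf_of_mul_mem (by omega) (by omega) hwB
      · refine fun x hx => mem_altInf.2 fun s hs => ?_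
        rw [altSets_succ_succ] at hs
        rcases hs with ⟨s, hs, rfl⟩ | hs
        · exact Ideal.span_mono (Set.image_mono (by simp)) (mem_altInf.1 hx s hs)
        · exact mem_altInf.1 (hAB hx) s hs
      · refine fun x hx => mem_altInf.2 fun s hs => ?_
        rw [altSets_succ_succ] at hs
        rcases hs with ⟨s, hs, rfl⟩ | hs
        · rw [span_image_insert]
          exact Ideal.mem_sup_right
            (Ideal.mul_le_right (I := altInf F (c + 1) t) (by rwa [mul_comm]))
        · exact mem_altInf.1 (Ideal.mul_le_right hx) s hs

/-- Induction along basic double links: `P c t (altInf F c t)` holds if `P` holds for the zero ideal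
in codimension `0` and passes to `A + (f)` and to `A + f B`, where `f` is one of the given elements
and a nonzerodivisor modulo `A`. The predicate `L` records what is known of these elements. -/
theorem altInf_induction {R : Type u} [CommRing R] {F : ℕ → R} {P : ℕ → ℕ → Ideal R → Prop}
    {L : R → Prop} (bot : ∀ t, P 0 t ⊥)
    (base : ∀ c A f, L f → (∀ y, f * y ∈ A → y ∈ A) → P c 0 A → P (c + 1) 0 (A ⊔ Ideal.span {f}))
    (step : ∀ c t A B f, L f → (∀ y, f * y ∈ A → y ∈ A) → A ≤ B →
      P c (t + 1) A → P (c + 1) t B → P (c + 1) (t + 1) (A ⊔ Ideal.span {f} * B))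
    (c t : ℕ) (h : IsGeneric F (2 * t + c) (c + 1)) (hL : ∀ a < 2 * t + c, L (F a)) :
    P c t (altInf F c t) := by
  induction c generalizing t with
  | zero => rw [altInf_zero]; exact bot t
  | succ c ihc =>
    induction t with
    | zero =>
      rw [altInf_succ_zero]
      exact base c _ _ (hL _ (by omega))
        (fun y hy => (h.mono le_rfl (by omega)).mem_altInf_of_mul_mem (by omega) (by omega) hy)
        (ihc 0 (h.mono (by omega) (by omega)) fun a ha => hL a (by omega))
    | succ t iht =>
      rw [altInf_eq_linkIdeal _ _ F h, linkIdeal,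
        ← altInf_eq_linkIdeal _ _ F (h.mono (by omega) (by omega)),
        ← altInf_eq_linkIdeal _ _ F (h.mono (by omega) le_rfl)]
      exact step c t _ _ _ (hL _ (by omega))
        (fun y hy => (h.mono le_rfl (by omega)).mem_altInf_of_mul_mem (by omega) (by omega) hy)
        (altInf_le_altInf_succ c t)
        (ihc (t + 1) (h.mono (by omega) (by omega)) fun a ha => hL a (by omega))
        (iht (h.mono (by omega) le_rfl) fun a ha => hL a (by omega))

end LinearConfig

/-! ### The components of `Z_{c,t}` -/

namespace LinearConfig

open MvPolynomial

universe u

theorem card_filter_lt_of_mem_altSets {c t : ℕ} {s : Finset ℕ} (hs : s ∈ altSets c t) {x : ℕ}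
    (hx : x ∈ s) : (s.filter (· < x)).card % 2 = x % 2 := by
  obtain ⟨m, hm, hle, rfl⟩ := hs
  have hg : StrictMono fun k => 2 * m k + k := fun a b hab => by
    have := hm hab.le
    dsimp only
    omega
  obtain ⟨k, hk, rfl⟩ := Finset.mem_image.1 hx
  have : ((Finset.range c).image fun k => 2 * m k + k).filter (· < 2 * m k + k) =
      (Finset.range k).image fun k => 2 * m k + k := by
    ext y
    simp only [Finset.mem_filter, Finset.mem_image, Finset.mem_range] at hk ⊢
    constructor
    · rintro ⟨⟨j, hj, rfl⟩, h⟩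
      exact ⟨j, hg.lt_iff_lt.1 h, rfl⟩
    · rintro ⟨j, hj, rfl⟩
      exact ⟨⟨j, hj.trans hk, rfl⟩, hg hj⟩
  rw [this, Finset.card_image_of_injective _ hg.injective, Finset.card_range]
  omega

/-- In a set of `altSets c t` every element has the parity of its position. Hence two elements whose
removal from `U` leaves such sets have no element of `U` between them. -/
theorem not_between_of_erase_altSets {c t : ℕ} {U : Finset ℕ} {x y z : ℕ} (hxy : x < y)
    (hyz : y < z) (hx : x ∈ U) (hy : y ∈ U) (h₁ : U.erase x ∈ altSets c t)
    (h₃ : U.erase z ∈ altSets c t) : False := by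
  have e₁ := card_filter_lt_of_mem_altSets h₁ (Finset.mem_erase.2 ⟨hxy.ne', hy⟩)
  have e₃ := card_filter_lt_of_mem_altSets h₃ (Finset.mem_erase.2 ⟨hyz.ne, hy⟩)
  have f₁ : (U.erase x).filter (· < y) = (U.filter (· < y)).erase x := by
    ext; simp only [Finset.mem_filter, Finset.mem_erase]; tauto
  have f₃ : (U.erase z).filter (· < y) = U.filter (· < y) := by
    ext w
    simp only [Finset.mem_filter, Finset.mem_erase]
    constructor
    · tauto
    · rintro ⟨hw, hwy⟩; exact ⟨⟨by omega, hw⟩, hwy⟩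
  have hmem : x ∈ U.filter (· < y) := Finset.mem_filter.2 ⟨hx, hxy⟩
  have := Finset.card_erase_add_one hmem
  rw [f₁] at e₁
  rw [f₃] at e₃
  omega

/-- Otherwise the three sets arise from one set of `c + 1` elements by removing one element each, and
the middle one of the removed elements lies between the other two. -/
theorem add_two_le_card_union {c t : ℕ} {s₁ s₂ s₃ : Finset ℕ} (h₁ : s₁ ∈ altSets c t)
    (h₂ : s₂ ∈ altSets c t) (h₃ : s₃ ∈ altSets c t) (h₁₂ : s₁ ≠ s₂) (h₁₃ : s₁ ≠ s₃)
    (h₂₃ : s₂ ≠ s₃) : c + 2 ≤ (s₁ ∪ s₂ ∪ s₃).card := by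
  by_contra! hlt
  set U := s₁ ∪ s₂ ∪ s₃ with hU
  have c₁ := card_of_mem_altSets h₁
  have c₂ := card_of_mem_altSets h₂
  have c₃ := card_of_mem_altSets h₃
  have i₁ : s₁ ⊆ U := Finset.subset_union_left.trans Finset.subset_union_left
  have i₂ : s₂ ⊆ U := Finset.subset_union_right.trans Finset.subset_union_left
  have i₃ : s₃ ⊆ U := Finset.subset_union_right
  have hcard : U.card = c + 1 := by
    have : c < U.card := by
      by_contra! h
      exact h₁₂ ((Finset.eq_of_subset_of_card_le i₁ (by omega)).trans
        (Finset.eq_of_subset_of_card_le i₂ (by omega)).symm)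
    omega
  have key : ∀ s ∈ altSets c t, s ⊆ U → ∃ x ∈ U, s = U.erase x := by
    intro s hs hsU
    have cs := card_of_mem_altSets hs
    obtain ⟨x, hx, h⟩ := (Finset.exists_eq_insert_iff).2 ⟨hsU, by omega⟩
    exact ⟨x, h ▸ Finset.mem_insert_self x s, by rw [← h, Finset.erase_insert hx]⟩
  obtain ⟨x₁, m₁, e₁⟩ := key s₁ h₁ i₁
  obtain ⟨x₂, m₂, e₂⟩ := key s₂ h₂ i₂
  obtain ⟨x₃, m₃, e₃⟩ := key s₃ h₃ i₃
  have n₁₂ : x₁ ≠ x₂ := by rintro rfl; exact h₁₂ (e₁.trans e₂.symm)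
  have n₁₃ : x₁ ≠ x₃ := by rintro rfl; exact h₁₃ (e₁.trans e₃.symm)
  have n₂₃ : x₂ ≠ x₃ := by rintro rfl; exact h₂₃ (e₂.trans e₃.symm)
  rw [e₁] at h₁
  rw [e₂] at h₂
  rw [e₃] at h₃
  rcases n₁₂.lt_or_gt with a | a <;> rcases n₁₃.lt_or_gt with b | b <;>
    rcases n₂₃.lt_or_gt with d | d
  · exact not_between_of_erase_altSets a d m₁ m₂ h₁ h₃
  · exact not_between_of_erase_altSets b d m₁ m₃ h₁ h₂
  · omega
  · exact not_between_of_erase_altSets b a m₃ m₁ h₃ h₂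
  · exact not_between_of_erase_altSets a b m₂ m₁ h₂ h₃
  · omega
  · exact not_between_of_erase_altSets d b m₂ m₃ h₂ h₁
  · exact not_between_of_erase_altSets d a m₃ m₂ h₃ h₁

section

variable {K : Type u} [Field K] {σ : Type*}

/-- The first `N` members of `F` are linear forms, and any at most `q` of them are linearly
independent. -/
structure IsLinearlyGeneric (F : ℕ → MvPolynomial σ K) (N q : ℕ) : Prop where
  linear : ∀ a < N, (F a).IsHomogeneous 1
  indep : ∀ s : Finset ℕ, s ⊆ Finset.range N → s.card ≤ q → LinearIndepOn K F (s : Set ℕ)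

variable {F : ℕ → MvPolynomial σ K} {c t q : ℕ}

theorem IsLinearlyGeneric.mono {N q q' : ℕ} (h : IsLinearlyGeneric F N q) (hq : q' ≤ q) :
    IsLinearlyGeneric F N q' where
  linear := h.linear
  indep s hs hc := h.indep s hs (hc.trans hq)

theorem IsLinearlyGeneric.linear_of_mem {N : ℕ} (h : IsLinearlyGeneric F N q) {s : Finset ℕ}
    (hs : s ⊆ Finset.range N) : ∀ a ∈ s, (F a).IsHomogeneous 1 :=
  fun a ha => h.linear a (Finset.mem_range.1 (hs ha))

theorem IsLinearlyGeneric.isGeneric {N : ℕ} (h : IsLinearlyGeneric F N q) : IsGeneric F N q where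
  isPrime s hs _ := isPrime_span_of_linear (by
    rintro _ ⟨a, ha, rfl⟩
    exact h.linear_of_mem hs a ha)
  notMem s hs hc a ha has := by
    have hsub : insert a s ⊆ Finset.range N :=
      Finset.insert_subset (Finset.mem_range.2 ha) hs
    refine notMem_span_image has (fun b hb => h.linear_of_mem hsub b (by simpa using hb)) ?_
    simpa using h.indep _ hsub (by rw [Finset.card_insert_of_notMem has]; omega)

theorem IsLinearlyGeneric.isPrime_of_mem_altSets (h : IsLinearlyGeneric F (2 * t + c) q)
    {s : Finset ℕ} (hs : s ∈ altSets c t) : (Ideal.span (F '' (s : Set ℕ))).IsPrime :=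
  isPrime_span_of_linear (by
    rintro _ ⟨a, ha, rfl⟩
    exact h.linear_of_mem (subset_range_of_mem_altSets hs) a ha)

theorem IsLinearlyGeneric.isRadical_altInf (h : IsLinearlyGeneric F (2 * t + c) q) :
    (altInf F c t).IsRadical := by
  rintro x ⟨k, hk⟩
  rw [mem_altInf] at hk ⊢
  exact fun s hs => (h.isPrime_of_mem_altSets hs).mem_of_pow_mem k (hk s hs)

theorem exists_span_le_of_altInf_le {p : Ideal (MvPolynomial σ K)} [p.IsPrime]
    (hp : altInf F c t ≤ p) : ∃ s ∈ altSets c t, Ideal.span (F '' (s : Set ℕ)) ≤ p := by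
  have hfin := altSets_finite c t
  have : (hfin.toFinset.inf fun s => Ideal.span (F '' (s : Set ℕ))) ≤ p := by
    refine le_trans ?_ hp
    rw [Finset.inf_eq_iInf]
    simp [altInf]
  obtain ⟨s, hs, h⟩ := (Ideal.IsPrime.inf_le' ‹p.IsPrime›).1 this
  exact ⟨s, hfin.mem_toFinset.1 hs, h⟩

theorem IsLinearlyGeneric.mem_minimalPrimes (h : IsLinearlyGeneric F (2 * t + c) q)
    {p : Ideal (MvPolynomial σ K)} (hp : p ∈ (altInf F c t).minimalPrimes) :
    ∃ s ∈ altSets c t, p = Ideal.span (F '' (s : Set ℕ)) := by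
  have hpp : p.IsPrime := hp.1.1
  obtain ⟨s, hs, hle⟩ := exists_span_le_of_altInf_le hp.1.2
  refine ⟨s, hs, le_antisymm (hp.2 ⟨h.isPrime_of_mem_altSets hs, ?_⟩ hle) hle⟩
  exact fun x hx => mem_altInf.1 hx s hs

variable [Finite σ]

theorem IsLinearlyGeneric.height_altInf (h : IsLinearlyGeneric F (2 * t + c) c) :
    (altInf F c t).height = c := by
  refine le_antisymm ?_ ?_
  · obtain ⟨s, hs⟩ := altSets_nonempty c t
    have h1 := span_image_height_le s (h.linear_of_mem (subset_range_of_mem_altSets hs))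
    rw [card_of_mem_altSets hs] at h1
    exact le_trans (Ideal.height_mono fun x hx => mem_altInf.1 hx s hs) h1
  · rw [Ideal.height_eq_inf_minimalPrimes]
    refine le_iInf₂ fun p hp => ?_
    obtain ⟨s, hs, rfl⟩ := h.mem_minimalPrimes hp
    have hc := card_of_mem_altSets hs
    have hr := subset_range_of_mem_altSets hs
    have := card_le_height_span_image s (h.linear_of_mem hr) (h.indep s hr hc.le)
    rwa [hc] at this

theorem IsLinearlyGeneric.cmDepth_altInf (h : IsLinearlyGeneric F (2 * t + c) (c + 1)) :
    CMDepth (altInf F c t) c := by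
  refine altInf_induction (P := fun c _ I => CMDepth I c) (L := fun _ => True) (fun _ => .bot)
    (fun c A f _ hf hA => ?_) (fun c t A B f _ hf hAB hA hB => hA.doubleLink hAB hf hB)
    c t h.isGeneric fun _ _ => trivial
  have := hA.doubleLink le_top hf (.top (c + 1))
  rwa [Ideal.mul_top] at this

theorem ringKrullDim_quotient_altInf (h : IsLinearlyGeneric F (2 * t + c) c) :
    ringKrullDim (MvPolynomial σ K ⧸ altInf F c t) = ((Nat.card σ - c : ℕ) : WithBot ℕ∞) := by
  refine eq_natCast_sub_of_add_le (ringKrullDim_quotient_add_le h.height_altInf.ge) ?_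
  obtain ⟨s, hs⟩ := altSets_nonempty c t
  have h1 := natCard_le_ringKrullDim_quotient_add s
    (h.linear_of_mem (subset_range_of_mem_altSets hs))
  rw [card_of_mem_altSets hs] at h1
  refine h1.trans (add_le_add_left ?_ _)
  have hle : altInf F c t ≤ Ideal.span (F '' (s : Set ℕ)) := fun x hx => mem_altInf.1 hx s hs
  exact ringKrullDim_le_of_surjective (Ideal.Quotient.factor hle)
    (Ideal.Quotient.factor_surjective hle)

end

section

variable {K : Type u} [Field K] {n c t : ℕ}

theorem IsLinearlyGeneric.isGeneralizedStickFigure {F : ℕ → MvPolynomial (Fin (n + 1)) K}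
    (hc : c < n + 1) (h : IsLinearlyGeneric F (2 * t + c) (c + 2)) :
    IsGeneralizedStickFigure (altInf F c t) (n - c) where
  radical := h.isRadical_altInf
  linear P hP := by
    obtain ⟨s, hs, rfl⟩ := h.mem_minimalPrimes hP
    refine ⟨_, ?_, rfl⟩
    rintro _ ⟨a, ha, rfl⟩
    exact h.linear_of_mem (subset_range_of_mem_altSets hs) a ha
  dim P hP := by
    obtain ⟨s, hs, rfl⟩ := h.mem_minimalPrimes hP
    have hr := subset_range_of_mem_altSets hs
    have hcard := card_of_mem_altSets hs
    rw [ringKrullDim_quotient_span_image s (h.linear_of_mem hr) (h.indep s hr (by omega)), hcard,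
      Nat.card_eq_fintype_card, Fintype.card_fin]
    congr 1
    omega
  triple P₁ h₁ P₂ h₂ P₃ h₃ h₁₂ h₁₃ h₂₃ := by
    obtain ⟨s₁, hs₁, rfl⟩ := h.mem_minimalPrimes h₁
    obtain ⟨s₂, hs₂, rfl⟩ := h.mem_minimalPrimes h₂
    obtain ⟨s₃, hs₃, rfl⟩ := h.mem_minimalPrimes h₃
    have hU := add_two_le_card_union hs₁ hs₂ hs₃ (fun e => h₁₂ (e ▸ rfl)) (fun e => h₁₃ (e ▸ rfl))
      (fun e => h₂₃ (e ▸ rfl))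
    obtain ⟨u, hu, hucard⟩ := Finset.exists_subset_card_eq hU
    have hur : u ⊆ Finset.range (2 * t + c) := hu.trans (Finset.union_subset (Finset.union_subset
      (subset_range_of_mem_altSets hs₁) (subset_range_of_mem_altSets hs₂))
      (subset_range_of_mem_altSets hs₃))
    have hht := card_le_height_span_image u (h.linear_of_mem hur) (h.indep u hur hucard.le)
    have hle : Ideal.span (F '' (u : Set ℕ)) ≤ Ideal.span (F '' (s₁ : Set ℕ)) ⊔
        Ideal.span (F '' (s₂ : Set ℕ)) ⊔ Ideal.span (F '' (s₃ : Set ℕ)) := by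
      rw [← Ideal.span_union, ← Ideal.span_union, ← Set.image_union, ← Set.image_union]
      exact Ideal.span_mono (Set.image_mono (by exact_mod_cast hu))
    have hdim := ringKrullDim_quotient_add_le (hht.trans (Ideal.height_mono hle))
    rw [hucard, Nat.card_eq_fintype_card, Fintype.card_fin] at hdim
    -- cancel `c + 1` in `dim + (c + 2) ≤ n + 1`
    refine (ENat.WithBot.add_le_add_natCast_right_iff (c := c + 1)).1 ?_
    rw [← Nat.cast_add, show n - c + (c + 1) = n + 1 by omega]
    convert hdim using 1
    rw [add_assoc]
    norm_cast
    congr 2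
    omega

/-- The forms in the order `M_0, L_0, M_1, L_1, …`. -/
def interleave {R : Type*} (M L : ℕ → R) (j : ℕ) : R := if Even j then M (j / 2) else L (j / 2)

theorem interleave_two_mul_add {R : Type*} (M L : ℕ → R) (m k : ℕ) :
    interleave M L (2 * m + k) = if Even k then M (m + k / 2) else L (m + k / 2) := by
  have h1 : Even (2 * m + k) ↔ Even k := by simp [Nat.even_add]
  have h2 : (2 * m + k) / 2 = m + k / 2 := by omega
  simp only [interleave, h1, h2]

theorem span_interleave_eq_altIdeal (M L : ℕ → MvPolynomial (Fin (n + 1)) K) {m : ℕ → ℕ}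
    {i : Fin c → ℕ} (h : ∀ k : Fin c, i k = m k + k / 2) :
    Ideal.span (interleave M L '' ((Finset.range c).image fun k => 2 * m k + k : Finset ℕ)) =
      altIdeal M L c i := by
  rw [altIdeal]
  congr 1
  ext x
  simp only [Finset.coe_image, Finset.coe_range, Set.mem_image, Set.mem_Iio, Set.mem_range,
    exists_exists_and_eq_and, interleave_two_mul_add]
  constructor
  · rintro ⟨k, hk, rfl⟩
    exact ⟨⟨k, hk⟩, by simp only [h]⟩
  · rintro ⟨k, rfl⟩
    exact ⟨k, k.2, by simp only [h]⟩

theorem isAdmissible_of_monotone {m : ℕ → ℕ} (hm : Monotone m) (ht : ∀ k, m k ≤ t) :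
    IsAdmissible c t fun k : Fin c => m k + k / 2 := by
  refine ⟨fun k => ?_, fun k l hkl => ?_⟩
  · have := ht k
    have := k.2
    dsimp only
    omega
  · have := hm (show (k : ℕ) ≤ l by omega)
    dsimp only
    split_ifs with he
    · omega
    · rw [Nat.not_even_iff] at he
      omega

/-- The inverse substitution `m_k = i_k - ⌊k/2⌋`; the subtraction does not truncate. -/
theorem exists_monotone_of_isAdmissible {i : Fin c → ℕ} (hi : IsAdmissible c t i) :
    ∃ m : ℕ → ℕ, Monotone m ∧ (∀ k, m k ≤ t) ∧ ∀ k : Fin c, i k = m k + k / 2 := by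
  cases c with
  | zero => exact ⟨fun _ => 0, monotone_const, fun _ => Nat.zero_le _, fun k => k.elim0⟩
  | succ c =>
    have hstep : ∀ k : Fin c, i k.castSucc + (k + 1) / 2 ≤ i k.succ + k / 2 := by
      intro k
      have := hi.2 k.castSucc k.succ (by simp)
      split_ifs at this with he
      · rw [Fin.val_castSucc, Nat.even_iff] at he
        omega
      · rw [Fin.val_castSucc, Nat.not_even_iff] at he
        omega
    have hge : ∀ k : Fin (c + 1), (k : ℕ) / 2 ≤ i k := by
      intro k
      induction k using Fin.induction with
      | zero => simp
      | succ k ih =>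
        have := hstep k
        simp only [Fin.val_castSucc, Fin.val_succ] at ih ⊢
        omega
    have hmono : Monotone fun k : Fin (c + 1) => i k - k / 2 := by
      rw [Fin.monotone_iff_le_succ]
      intro k
      have := hstep k
      have := hge k.castSucc
      have := hge k.succ
      simp only [Fin.val_castSucc, Fin.val_succ] at *
      omega
    refine ⟨fun k => i ⟨min k c, by omega⟩ - min k c / 2, ?_, ?_, ?_⟩
    · intro a b hab
      exact hmono (a := ⟨min a c, by omega⟩) (b := ⟨min b c, by omega⟩)
        (Fin.mk_le_mk.2 (min_le_min_right c hab))
    · intro k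
      have h1 := hmono (Fin.le_last ⟨min k c, by omega⟩)
      have h2 := hi.1 (Fin.last c)
      simp only [Fin.val_last] at h1 h2
      dsimp only
      omega
    · intro k
      have hk : min (k : ℕ) c = k := by omega
      have := hge k
      simp only [hk, Fin.eta]
      omega

theorem idealZ_eq_altInf (M L : ℕ → MvPolynomial (Fin (n + 1)) K) (c t : ℕ) :
    idealZ M L c t = altInf (interleave M L) c t := by
  refine le_antisymm ?_ ?_
  · refine le_iInf₂ ?_
    rintro s ⟨m, hm, ht, rfl⟩
    rw [span_interleave_eq_altIdeal M L fun _ => rfl]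
    exact iInf₂_le _ (isAdmissible_of_monotone hm ht)
  · refine le_iInf₂ fun i hi => ?_
    obtain ⟨m, hm, ht, h⟩ := exists_monotone_of_isAdmissible hi
    rw [← span_interleave_eq_altIdeal M L h]
    exact iInf₂_le _ ⟨m, hm, ht, rfl⟩

theorem isLinearlyGeneric_interleave {M L : ℕ → MvPolynomial (Fin (n + 1)) K} {q : ℕ}
    (hM : ∀ i < t + (c + 1) / 2, (M i).IsHomogeneous 1)
    (hL : ∀ i < t + c / 2, (L i).IsHomogeneous 1)
    (h : SubsetsHaveCodim M L c t (min q (2 * t + c))) :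
    IsLinearlyGeneric (interleave M L) (2 * t + c) q := by
  have hlin : ∀ a < 2 * t + c, (interleave M L a).IsHomogeneous 1 := by
    intro a ha
    rw [interleave]
    split_ifs with he
    · exact hM _ (by omega)
    · rw [Nat.not_even_iff] at he
      exact hL _ (by omega)
  refine ⟨hlin, fun s hs hcard => ?_⟩
  obtain ⟨s', hss', hs', hcard'⟩ := Finset.exists_subsuperset_card_eq hs
    (n := min q (2 * t + c)) (le_min hcard (by simpa using Finset.card_le_card hs))
    (by simp)
  refine LinearIndepOn.mono ?_ (Finset.coe_subset.2 hss')
  refine linearIndepOn_of_card_le_height s' (fun a ha => hlin a (Finset.mem_range.1 (hs' ha))) ?_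
  -- the position of each form in the interleaved list
  let e : Fin (t + (c + 1) / 2) ⊕ Fin (t + c / 2) → ℕ :=
    Sum.elim (fun a => 2 * a) (fun b => 2 * b + 1)
  have he : Function.Injective e := by
    rintro (a | a) (b | b) hab <;> simp only [e, Sum.elim_inl, Sum.elim_inr] at hab
    · exact congrArg _ (Fin.ext (by omega))
    · omega
    · omega
    · exact congrArg _ (Fin.ext (by omega))
  have hrange : (s' : Set ℕ) ⊆ Set.range e := by
    intro a ha
    have := Finset.mem_range.1 (hs' ha)
    rcases Nat.even_or_odd' a with ⟨b, rfl | rfl⟩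
    · exact ⟨Sum.inl ⟨b, by omega⟩, rfl⟩
    · exact ⟨Sum.inr ⟨b, by omega⟩, rfl⟩
  have hforms : forms M L c t = interleave M L ∘ e := by
    ext1 x
    rcases x with a | a
    · simp [forms, e, interleave]
    · have : (2 * (a : ℕ) + 1) / 2 = a := by omega
      simp [forms, e, interleave, this]
  have himg : e '' (s'.preimage e he.injOn : Finset _) = s' := by
    rw [Finset.coe_preimage, Set.image_preimage_eq_of_subset hrange]
  have h1 := h (s'.preimage e he.injOn) (by
    rw [← hcard', ← Finset.card_image_of_injective _ he]
    congr 1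
    exact Finset.coe_injective (by rw [Finset.coe_image, himg]))
  rw [hforms, Set.image_comp, himg] at h1
  rw [h1, hcard']

end

end LinearConfig

/-! ### Hilbert series -/

namespace LinearConfig

open MvPolynomial RingTheory.Sequence Pointwise

universe u

section

variable {σ K : Type*} [Field K]

theorem homogeneousComponent_linear_mul {f : MvPolynomial σ K} (hf : f.IsHomogeneous 1)
    (b : MvPolynomial σ K) (j : ℕ) :
    homogeneousComponent (j + 1) (f * b) = f * homogeneousComponent j b := by
  conv_lhs => rw [← sum_homogeneousComponent b, Finset.mul_sum, map_sum]
  have h : ∀ i, homogeneousComponent (j + 1) (f * homogeneousComponent i b) =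
      if i = j then f * homogeneousComponent j b else 0 := by
    intro i
    rw [homogeneousComponent_of_mem (hf.mul (homogeneousComponent_isHomogeneous i b))]
    by_cases hij : i = j
    · subst hij; simp [add_comm]
    · rw [if_neg (by omega), if_neg hij]
  simp_rw [h]
  rw [Finset.sum_ite_eq']
  split_ifs with hj
  · rfl
  · rw [homogeneousComponent_eq_zero _ _ (by simpa using hj), mul_zero]

theorem homogeneousComponent_zero_linear_mul {f : MvPolynomial σ K} (hf : f.IsHomogeneous 1)
    (b : MvPolynomial σ K) : homogeneousComponent 0 (f * b) = 0 := by
  have h0 : coeff 0 f = 0 := hf.coeff_eq_zero (by simp)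
  rw [homogeneousComponent_zero, ← constantCoeff_eq, map_mul, constantCoeff_eq, h0]
  simp

/-- An ideal containing the homogeneous components of its elements. -/
def IsHomogIdeal (I : Ideal (MvPolynomial σ K)) : Prop :=
  ∀ x ∈ I, ∀ j, homogeneousComponent j x ∈ I

theorem isHomogIdeal_bot : IsHomogIdeal (⊥ : Ideal (MvPolynomial σ K)) := by
  intro x hx j
  rw [Ideal.mem_bot.1 hx, map_zero]
  exact zero_mem _

theorem isHomogIdeal_top : IsHomogIdeal (⊤ : Ideal (MvPolynomial σ K)) := fun _ _ _ => trivial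

theorem IsHomogIdeal.doubleLink {A B : Ideal (MvPolynomial σ K)} (hA : IsHomogIdeal A)
    (hB : IsHomogIdeal B) {f : MvPolynomial σ K} (hf : f.IsHomogeneous 1) :
    IsHomogIdeal (A ⊔ Ideal.span {f} * B) := by
  intro x hx j
  obtain ⟨a, ha, v, hv, rfl⟩ := Submodule.mem_sup.1 hx
  obtain ⟨b, hb, rfl⟩ := Ideal.mem_span_singleton_mul.1 hv
  rw [map_add]
  refine Submodule.add_mem_sup (hA a ha j) ?_
  cases j with
  | zero => rw [homogeneousComponent_zero_linear_mul hf]; exact zero_mem _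
  | succ j =>
    rw [homogeneousComponent_linear_mul hf]
    exact Ideal.mul_mem_mul (Ideal.mem_span_singleton_self f) (hB b hb j)

end

section

variable {K : Type*} [Field K] {n : ℕ}

/-- The space of forms of degree `j` in the ideal `I`. -/
noncomputable def gradedPart (I : Ideal (MvPolynomial (Fin (n + 1)) K)) (j : ℕ) :
    Submodule K (MvPolynomial (Fin (n + 1)) K) :=
  homogeneousSubmodule (Fin (n + 1)) K j ⊓ I.restrictScalars K

variable {I A B : Ideal (MvPolynomial (Fin (n + 1)) K)} {f : MvPolynomial (Fin (n + 1)) K}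

theorem mem_gradedPart {j : ℕ} {x : MvPolynomial (Fin (n + 1)) K} :
    x ∈ gradedPart I j ↔ x.IsHomogeneous j ∧ x ∈ I := Iff.rfl

instance finiteDimensional_homogeneousSubmodule (j : ℕ) :
    FiniteDimensional K (homogeneousSubmodule (Fin (n + 1)) K j) :=
  Module.Finite.iff_fg.2 (homogeneousSubmodule_fg _ _ j)

instance finiteDimensional_gradedPart (j : ℕ) : FiniteDimensional K (gradedPart I j) :=
  Submodule.finiteDimensional_inf_left _ _

theorem hilbertFunction_add_finrank_gradedPart (I : Ideal (MvPolynomial (Fin (n + 1)) K))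
    (j : ℕ) :
    hilbertFunction I j + Module.finrank K (gradedPart I j) =
      Module.finrank K (homogeneousSubmodule (Fin (n + 1)) K j) := by
  have h := LinearMap.finrank_range_add_finrank_ker
    ((Ideal.Quotient.mkₐ K I).toLinearMap.domRestrict (homogeneousSubmodule (Fin (n + 1)) K j))
  rw [LinearMap.range_domRestrict, LinearMap.ker_domRestrict] at h
  rw [hilbertFunction, ← h]
  congr 1
  have hker : LinearMap.ker (Ideal.Quotient.mkₐ K I).toLinearMap = I.restrictScalars K := by
    ext x
    simp [Ideal.Quotient.eq_zero_iff_mem]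
  rw [hker, gradedPart, ← Submodule.map_comap_subtype]
  exact Submodule.finrank_map_subtype_eq _ _

theorem hilbertFunction_top (j : ℕ) :
    hilbertFunction (⊤ : Ideal (MvPolynomial (Fin (n + 1)) K)) j = 0 := by
  have h := hilbertFunction_add_finrank_gradedPart (⊤ : Ideal (MvPolynomial (Fin (n + 1)) K)) j
  have : gradedPart (⊤ : Ideal (MvPolynomial (Fin (n + 1)) K)) j =
      homogeneousSubmodule (Fin (n + 1)) K j := by
    ext x; simp [mem_gradedPart]
  rw [this] at h
  omega

theorem gradedPart_doubleLink_zero (hA : IsHomogIdeal A) (hf : f.IsHomogeneous 1) :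
    gradedPart (A ⊔ Ideal.span {f} * B) 0 = gradedPart A 0 := by
  ext x
  refine and_congr_right fun hx => ⟨fun h => ?_, fun h => Ideal.mem_sup_left h⟩
  obtain ⟨a, ha, v, hv, rfl⟩ := Submodule.mem_sup.1 h
  obtain ⟨b, hb, rfl⟩ := Ideal.mem_span_singleton_mul.1 hv
  have := homogeneousComponent_eq_self hx
  rw [map_add, homogeneousComponent_zero_linear_mul hf, add_zero] at this
  rw [← this]
  exact hA a ha 0

theorem gradedPart_doubleLink_succ (hA : IsHomogIdeal A) (hB : IsHomogIdeal B)
    (hf : f.IsHomogeneous 1) (j : ℕ) :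
    gradedPart (A ⊔ Ideal.span {f} * B) (j + 1) =
      gradedPart A (j + 1) ⊔ (gradedPart B j).map (LinearMap.mulLeft K f) := by
  apply le_antisymm
  · rintro x ⟨hx, h⟩
    obtain ⟨a, ha, v, hv, rfl⟩ := Submodule.mem_sup.1 h
    obtain ⟨b, hb, rfl⟩ := Ideal.mem_span_singleton_mul.1 hv
    have := homogeneousComponent_eq_self hx
    rw [map_add, homogeneousComponent_linear_mul hf] at this
    rw [← this]
    exact Submodule.add_mem_sup ⟨homogeneousComponent_isHomogeneous _ _, hA a ha _⟩
      ⟨_, ⟨homogeneousComponent_isHomogeneous _ _, hB b hb _⟩, rfl⟩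
  · refine sup_le (fun x hx => ⟨hx.1, Ideal.mem_sup_left hx.2⟩) ?_
    rintro _ ⟨x, hx, rfl⟩
    refine ⟨?_, Ideal.mem_sup_right (Ideal.mul_mem_mul (Ideal.mem_span_singleton_self f) hx.2)⟩
    simpa [add_comm] using hf.mul hx.1

theorem gradedPart_inf_map (hAB : A ≤ B) (hnzd : ∀ y, f * y ∈ A → y ∈ A)
    (hf : f.IsHomogeneous 1) (j : ℕ) :
    gradedPart A (j + 1) ⊓ (gradedPart B j).map (LinearMap.mulLeft K f) =
      (gradedPart A j).map (LinearMap.mulLeft K f) := by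
  apply le_antisymm
  · rintro _ ⟨h, ⟨x, hx, rfl⟩⟩
    exact ⟨x, ⟨hx.1, hnzd x h.2⟩, rfl⟩
  · rintro _ ⟨x, hx, rfl⟩
    refine ⟨⟨?_, A.mul_mem_left f hx.2⟩, x, ⟨hx.1, hAB hx.2⟩, rfl⟩
    simpa [add_comm] using hf.mul hx.1

/-- The Hilbert series of `R/I`, with integer coefficients. -/
noncomputable def hilbertSeries (I : Ideal (MvPolynomial (Fin (n + 1)) K)) : PowerSeries ℤ :=
  PowerSeries.mk fun j => (hilbertFunction I j : ℤ)

/-- In each degree `A + f B` is the sum of `A` and `f B`, which meet in `f A`. -/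
theorem hilbertFunction_doubleLink_succ (hA : IsHomogIdeal A) (hB : IsHomogIdeal B)
    (hf : f.IsHomogeneous 1) (hnzd : ∀ y, f * y ∈ A → y ∈ A) (hAB : A ≤ B) (j : ℕ) :
    hilbertFunction (A ⊔ Ideal.span {f} * B) (j + 1) + hilbertFunction A j =
      hilbertFunction A (j + 1) + hilbertFunction B j := by
  -- `f = 0` can only be a nonzerodivisor modulo the unit ideal
  by_cases hf0 : f = 0
  · have hAtop : A = ⊤ := Ideal.eq_top_iff_one _ |>.2 (hnzd 1 (by simp [hf0]))
    obtain rfl : B = ⊤ := top_le_iff.1 (hAtop ▸ hAB)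
    simp [hAtop, hilbertFunction_top]
  · have hinj : Function.Injective (LinearMap.mulLeft K f) := mul_right_injective₀ hf0
    have h := Submodule.finrank_sup_add_finrank_inf_eq (gradedPart A (j + 1))
      ((gradedPart B j).map (LinearMap.mulLeft K f))
    rw [← gradedPart_doubleLink_succ hA hB hf, gradedPart_inf_map hAB hnzd hf,
      ← (Submodule.equivMapOfInjective _ hinj (gradedPart B j)).finrank_eq,
      ← (Submodule.equivMapOfInjective _ hinj (gradedPart A j)).finrank_eq] at h
    have h1 := hilbertFunction_add_finrank_gradedPart (A ⊔ Ideal.span {f} * B) (j + 1)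
    have h2 := hilbertFunction_add_finrank_gradedPart A (j + 1)
    have h3 := hilbertFunction_add_finrank_gradedPart A j
    have h4 := hilbertFunction_add_finrank_gradedPart B j
    omega

theorem hilbertSeries_doubleLink (hA : IsHomogIdeal A) (hB : IsHomogIdeal B)
    (hf : f.IsHomogeneous 1) (hnzd : ∀ y, f * y ∈ A → y ∈ A) (hAB : A ≤ B) :
    hilbertSeries (A ⊔ Ideal.span {f} * B) =
      (1 - PowerSeries.X) * hilbertSeries A + PowerSeries.X * hilbertSeries B := by
  ext j
  rw [sub_mul, one_mul]
  cases j with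
  | zero =>
    have h1 := hilbertFunction_add_finrank_gradedPart (A ⊔ Ideal.span {f} * B) 0
    have h2 := hilbertFunction_add_finrank_gradedPart A 0
    rw [gradedPart_doubleLink_zero hA hf] at h1
    simp [hilbertSeries]
    omega
  | succ j =>
    have := hilbertFunction_doubleLink_succ hA hB hf hnzd hAB j
    simp only [hilbertSeries, map_add, map_sub, PowerSeries.coeff_succ_X_mul, PowerSeries.coeff_mk]
    omega

theorem hilbertSeries_top : hilbertSeries (⊤ : Ideal (MvPolynomial (Fin (n + 1)) K)) = 0 := by
  ext j
  simp [hilbertSeries, hilbertFunction_top]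

theorem IsHomogIdeal.sup_span (hI : IsHomogIdeal I) (hf : f.IsHomogeneous 1) :
    IsHomogIdeal (I ⊔ Ideal.span {f}) := by
  simpa [Ideal.mul_top] using hI.doubleLink isHomogIdeal_top hf

theorem hilbertSeries_sup_span (hI : IsHomogIdeal I) (hf : f.IsHomogeneous 1)
    (hnzd : ∀ y, f * y ∈ I → y ∈ I) :
    hilbertSeries (I ⊔ Ideal.span {f}) = (1 - PowerSeries.X) * hilbertSeries I := by
  simpa [Ideal.mul_top, hilbertSeries_top] using
    hilbertSeries_doubleLink hI isHomogIdeal_top hf hnzd le_top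

/-- A regular sequence of linear forms multiplies the Hilbert series by a power of `1 - X`. -/
theorem hilbertSeries_sup_ofList (θ : List (MvPolynomial (Fin (n + 1)) K)) :
    ∀ I : Ideal (MvPolynomial (Fin (n + 1)) K), IsHomogIdeal I →
      (∀ f ∈ θ, f.IsHomogeneous 1) → IsWeaklyRegular (MvPolynomial (Fin (n + 1)) K ⧸ I) θ →
      hilbertSeries (I ⊔ Ideal.ofList θ) = (1 - PowerSeries.X) ^ θ.length * hilbertSeries I := by
  induction θ with
  | nil => intro I _ _ _; simp
  | cons f θ ih =>
    intro I hI hθ hreg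
    rw [isWeaklyRegular_cons_iff] at hreg
    have hf := hθ f (by simp)
    have hnzd : ∀ y, f * y ∈ I → y ∈ I := (isSMulRegular_quotient_iff_mem_of_smul_mem _ _).1 hreg.1
    have hmap : (f • ⊤ : Submodule (MvPolynomial (Fin (n + 1)) K)
        (MvPolynomial (Fin (n + 1)) K ⧸ I)) = Submodule.map I.mkQ (Ideal.span {f}) := by
      rw [← Submodule.ideal_span_singleton_smul]
      conv_rhs => rw [← Ideal.mul_top (Ideal.span {f}), ← smul_eq_mul, Submodule.map_smul'',
        Submodule.map_top, Submodule.range_mkQ]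
    have e := (Submodule.quotEquivOfEq _ _ hmap).trans
      (Submodule.quotientQuotientEquivQuotientSup I (Ideal.span {f}))
    have := ih (I ⊔ Ideal.span {f}) (hI.sup_span hf) (fun g hg => hθ g (by simp [hg]))
      ((e.isWeaklyRegular_congr θ).1 hreg.2)
    rw [Ideal.ofList_cons, ← sup_assoc, this, hilbertSeries_sup_span hI hf hnzd, List.length_cons,
      pow_succ, mul_assoc]


theorem hilbertSeries_idealOfVars : hilbertSeries (idealOfVars (Fin (n + 1)) K) = 1 := by
  have hpos : ∀ j ≠ 0, hilbertFunction (idealOfVars (Fin (n + 1)) K) j = 0 := by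
    intro j hj
    have hle : (homogeneousSubmodule (Fin (n + 1)) K j).map
        (Ideal.Quotient.mkₐ K (idealOfVars (Fin (n + 1)) K)).toLinearMap = ⊥ := by
      rw [eq_bot_iff]
      rintro _ ⟨x, hx, rfl⟩
      refine (Submodule.mem_bot K).2 (Ideal.Quotient.eq_zero_iff_mem.2 ?_)
      rw [← pow_one (idealOfVars (Fin (n + 1)) K), mem_pow_idealOfVars_iff]
      intro d hd
      have : d.degree = j := by
        by_contra hne
        exact mem_support_iff.1 hd (hx.coeff_eq_zero hne)
      omega
    rw [hilbertFunction, hle, finrank_bot]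
  have hzero : hilbertFunction (idealOfVars (Fin (n + 1)) K) 0 = 1 := by
    have hne : (1 : MvPolynomial (Fin (n + 1)) K ⧸ idealOfVars (Fin (n + 1)) K) ≠ 0 := by
      rw [← map_one (Ideal.Quotient.mk _), Ne, Ideal.Quotient.eq_zero_iff_mem,
        ← pow_one (idealOfVars (Fin (n + 1)) K), ← C_1, C_mem_pow_idealOfVars_iff]
      simp
    rw [hilbertFunction, homogeneousSubmodule_zero, Submodule.one_eq_span, Submodule.map_span,
      Set.image_singleton]
    exact finrank_span_singleton hne
  ext j
  by_cases hj : j = 0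
  · simp [hj, hilbertSeries, hzero]
  · simp [hilbertSeries, hpos j hj, PowerSeries.coeff_one, hj]

end

section

variable {K : Type u} [Field K] {n c t : ℕ}

/-- The variables, continued by zero. -/
noncomputable def extendedVars (K : Type u) [Field K] (n j : ℕ) : MvPolynomial (Fin (n + 1)) K :=
  if h : j < n + 1 then X ⟨j, h⟩ else 0

theorem extendedVars_coe (i : Fin (n + 1)) : extendedVars K n i = X i := by
  rw [extendedVars, dif_pos i.2]

theorem isLinearlyGeneric_extendedVars (q : ℕ) :
    IsLinearlyGeneric (extendedVars K n) (n + 1) q := by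
  refine ⟨fun a ha => ?_, fun s hs _ => ?_⟩
  · rw [extendedVars_coe ⟨a, ha⟩]
    exact isHomogeneous_X K _
  · have hli : LinearIndepOn K (extendedVars K n) (Set.range ((↑) : Fin (n + 1) → ℕ)) := by
      rw [linearIndepOn_range_iff Fin.val_injective]
      have h : extendedVars K n ∘ Fin.val = X := funext extendedVars_coe
      rw [h]
      exact linearIndependent_X _ K
    refine hli.mono fun a ha => ?_
    exact ⟨⟨a, Finset.mem_range.1 (hs ha)⟩, rfl⟩

/-- The Hilbert series of the polynomial ring, from the regular sequence of its variables. -/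
theorem hilbertSeries_bot_mul :
    hilbertSeries (⊥ : Ideal (MvPolynomial (Fin (n + 1)) K)) *
      (1 - PowerSeries.X) ^ (n + 1) = 1 := by
  have h := altInf_induction (F := extendedVars K n)
    (P := fun c t I => IsHomogIdeal I ∧ (t = 0 → hilbertSeries I = hilbertSeries
      (⊥ : Ideal (MvPolynomial (Fin (n + 1)) K)) * (1 - PowerSeries.X) ^ c))
    (L := fun f => f.IsHomogeneous 1) (fun t => ⟨isHomogIdeal_bot, fun _ => by simp⟩)
    (fun c A f hf hnzd hA => ⟨hA.1.sup_span hf, fun _ => ?_⟩)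
    (fun c t A B f hf _ _ hA hB =>
      ⟨hA.1.doubleLink hB.1 hf, fun h => absurd h (Nat.succ_ne_zero t)⟩)
    (n + 1) 0 ((isLinearlyGeneric_extendedVars _).isGeneric.mono (by omega) le_rfl)
    (fun a ha => (isLinearlyGeneric_extendedVars 0).linear a (by omega))
  · have hvars : altInf (extendedVars K n) (n + 1) 0 = idealOfVars (Fin (n + 1)) K := by
      rw [altInf_zero_right, idealOfVars]
      congr 1
      ext x
      simp only [Finset.coe_range, Set.mem_image, Set.mem_Iio, Set.mem_range]
      constructor
      · rintro ⟨j, hj, rfl⟩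
        exact ⟨⟨j, hj⟩, (extendedVars_coe _).symm⟩
      · rintro ⟨j, rfl⟩
        exact ⟨j, j.2, extendedVars_coe j⟩
    rw [← h.2 rfl, hvars, hilbertSeries_idealOfVars]
  · rw [hilbertSeries_sup_span hA.1 hf hnzd, hA.2 rfl, pow_succ]
    ring

/-- The polynomial `∑_{j ≤ t} binom(c + j - 1, j) z^j`. -/
noncomputable def hPolynomial (c t : ℕ) : PowerSeries ℤ :=
  PowerSeries.mk fun j => ((if j ≤ t then (c + j - 1).choose j else 0 : ℕ) : ℤ)

theorem hPolynomial_zero (t : ℕ) : hPolynomial 0 t = 1 := by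
  ext j
  rcases j with _ | j
  · simp [hPolynomial]
  · simp [hPolynomial, PowerSeries.coeff_one]

theorem hPolynomial_zero_right (c : ℕ) : hPolynomial c 0 = 1 := by
  ext j
  rcases j with _ | j
  · simp [hPolynomial]
  · simp [hPolynomial, PowerSeries.coeff_one]

theorem hPolynomial_succ_succ (c t : ℕ) :
    hPolynomial (c + 1) (t + 1) = hPolynomial c (t + 1) + PowerSeries.X * hPolynomial (c + 1) t := by
  ext j
  rcases j with _ | j
  · simp [hPolynomial]
  · have h1 : c + 1 + (j + 1) - 1 = c + j + 1 := by omega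
    have h2 : c + (j + 1) - 1 = c + j := by omega
    have h3 : c + 1 + j - 1 = c + j := by omega
    simp only [hPolynomial, map_add, PowerSeries.coeff_succ_X_mul, PowerSeries.coeff_mk, h1, h2, h3,
      Nat.add_le_add_iff_right]
    split_ifs
    · rw [Nat.choose_succ_succ, add_comm, Nat.cast_add]
    · simp

theorem IsLinearlyGeneric.hilbertSeries_altInf {F : ℕ → MvPolynomial (Fin (n + 1)) K}
    (h : IsLinearlyGeneric F (2 * t + c) (c + 1)) :
    IsHomogIdeal (altInf F c t) ∧ hilbertSeries (altInf F c t) * (1 - PowerSeries.X) ^ (n + 1) =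
      hPolynomial c t * (1 - PowerSeries.X) ^ c := by
  refine altInf_induction (P := fun c t I => IsHomogIdeal I ∧ hilbertSeries I *
      (1 - PowerSeries.X) ^ (n + 1) = hPolynomial c t * (1 - PowerSeries.X) ^ c)
    (L := fun f => f.IsHomogeneous 1) (fun t => ⟨isHomogIdeal_bot, ?_⟩)
    (fun c A f hf hnzd hA => ⟨hA.1.sup_span hf, ?_⟩)
    (fun c t A B f hf hnzd hAB hA hB => ⟨hA.1.doubleLink hB.1 hf, ?_⟩)
    c t h.isGeneric h.linear
  · rw [hilbertSeries_bot_mul, hPolynomial_zero, pow_zero, mul_one]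
  · have := hA.2
    rw [hPolynomial_zero_right] at this ⊢
    rw [hilbertSeries_sup_span hA.1 hf hnzd, mul_assoc, this, pow_succ]
    ring
  · rw [hilbertSeries_doubleLink hA.1 hB.1 hf hnzd hAB, add_mul, mul_assoc, mul_assoc, hA.2, hB.2,
      hPolynomial_succ_succ, pow_succ]
    ring

theorem IsLinearlyGeneric.hasHVector_altInf {F : ℕ → MvPolynomial (Fin (n + 1)) K}
    (hc : c < n + 1) (h : IsLinearlyGeneric F (2 * t + c) (c + 1)) :
    HasHVector (altInf F c t) fun j => if j ≤ t then (c + j - 1).choose j else 0 := by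
  have hdim := ringKrullDim_quotient_altInf (h.mono (Nat.le_succ c))
  rw [Nat.card_eq_fintype_card, Fintype.card_fin] at hdim
  obtain ⟨hhom, hser⟩ := h.hilbertSeries_altInf
  have hX : (1 - PowerSeries.X : PowerSeries ℤ) ≠ 0 := by
    intro h0
    simpa using congrArg PowerSeries.constantCoeff h0
  have hseries : hilbertSeries (altInf F c t) * (1 - PowerSeries.X) ^ (n + 1 - c) =
      hPolynomial c t := by
    refine mul_right_cancel₀ (pow_ne_zero c hX) ?_
    rw [mul_assoc, ← pow_add, Nat.sub_add_cancel hc.le, hser]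
  refine ⟨⟨n + 1 - c, hdim, hseries⟩, ?_⟩
  rintro J ⟨θ, hθ, hreg, hlen, rfl⟩ j
  have hlen' : θ.length = n + 1 - c := by
    rw [hdim] at hlen
    exact_mod_cast hlen.symm
  have := hilbertSeries_sup_ofList θ _ hhom hθ hreg.1
  rw [hlen', mul_comm, hseries] at this
  have := congrArg (PowerSeries.coeff j) this
  simp only [hilbertSeries, hPolynomial, PowerSeries.coeff_mk] at this
  exact_mod_cast this

end

end LinearConfig

theorem mainTheorem6 {K : Type*} [Field K] (n c t : ℕ) (hc : 1 ≤ c) (hn : c < n + 1)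
    (M L : ℕ → MvPolynomial (Fin (n + 1)) K)
    (hM : ∀ i < t + (c + 1) / 2, (M i).IsHomogeneous 1)
    (hL : ∀ i < t + c / 2, (L i).IsHomogeneous 1) :
    (LinearConfig.SubsetsHaveCodim M L c t (min (c + 1) (2 * t + c)) →
      (LinearConfig.idealZ M L c t).IsRadical ∧
      LinearConfig.IsCMRing
        (MvPolynomial (Fin (n + 1)) K ⧸ LinearConfig.idealZ M L c t) ∧
      (LinearConfig.idealZ M L c t).height = (c : ℕ∞) ∧
      LinearConfig.HasHVector (LinearConfig.idealZ M L c t)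
        (fun j => if j ≤ t then (c + j - 1).choose j else 0)) ∧
    (LinearConfig.SubsetsHaveCodim M L c t (min (c + 2) (2 * t + c)) →
      LinearConfig.IsGeneralizedStickFigure (LinearConfig.idealZ M L c t) (n - c)) := by
  rw [LinearConfig.idealZ_eq_altInf]
  refine ⟨fun h => ?_, fun h => ?_⟩
  · have hg := LinearConfig.isLinearlyGeneric_interleave hM hL h
    have hht := (hg.mono (Nat.le_succ c)).height_altInf
    exact ⟨hg.isRadical_altInf, hg.cmDepth_altInf.isCMRing hht.ge, hht, hg.hasHVector_altInf hn⟩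
  · exact (LinearConfig.isLinearlyGeneric_interleave hM hL h).isGeneralizedStickFigure hn
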